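/- Graphs are finite, undirected and loopless, and may have multiple edges. A graph is $k$-connected if it has more than $k$ vertices and remains connected after the deletion of any fewer than $k$ vertices; it is subcubic if every vertex is incident with at most three edges, counting multiplicities. A graph $G$ contains $H$ as an immersion if there are an injection $\phi\colon V(H)\to V(G)$ and a map $\psi$ that sends every edge of $H$ with ends $u,v$ to a path of $G$ between $\phi(u)$ and $\phi(v)$, so that distinct edges of $H$ are sent to edge-disjoint paths. Let $\mathcal I(H)$ be the class of all graphs that contain $H$ as an immersion. An $\mathcal I(H)$-vertex (edge) packing of $G$ is a collection of pairwise vertex-disjoint (edge-disjoint) subgraphs of $G$, each isomorphic to a graph in $\mathcal I(H)$; an $\mathcal I(H)$-vertex (edge) cover of $G$ is a set of vertices (edges) of $G$ that meets every subgraph of $G$ isomorphic to a graph in $\mathcal I(H)$. The class $\mathcal I(H)$ has the vertex (edge) Erdős–Pósa property if there is a function $f\colon\mathbb N\to\mathbb N$ such that for every graph $G$ and every $k\in\mathbb N$, either $G$ has an $\mathcal I(H)$-vertex (edge) packing of size $k$, or $G$ has an $\mathcal I(H)$-vertex (edge) cover of size at most $f(k)$. **Observation.** There exists a $3$-connected planar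 graph $H$ that is not subcubic such that $\mathcal I(H)$ has neither the vertex nor the edge Erdős–Pósa property. Moreover, this already fails for packings of size $2$: for every $n\in\mathbb N$ there is a graph $G$ that has neither two vertex-disjoint nor two edge-disjoint subgraphs in $\mathcal I(H)$, while every $\mathcal I(H)$-vertex cover and every $\mathcal I(H)$-edge cover of $G$ has more than $n$ elements. -/

import Mathlib

/-! Graphs are Mathlib multigraphs `Graph α β` (vertices in `α`, edges in `β`, parallel edges allowed,
`M ≤ G` for "`M` is a subgraph of `G`"), required to be finite and loopless where this matters. -/

namespace Graph

/-- `G` is finite and loopless (parallel edges are allowed). -/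
def IsFiniteLoopless {α β : Type} (G : Graph α β) : Prop :=
  V(G).Finite ∧ E(G).Finite ∧ G.Loopless

/-- Two multigraphs are isomorphic: there are bijections between the vertex sets and between the
edge sets that preserve and reflect the ends of edges. -/
def IsIsomorphic {α β α' β' : Type} (G : Graph α β) (G' : Graph α' β') : Prop :=
  ∃ (f : V(G) ≃ V(G')) (g : E(G) ≃ E(G')),
    ∀ (e : E(G)) (x y : V(G)), G.IsLink e x y ↔ G'.IsLink (g e) (f x) (f y)

/-! ### Walks, paths, connectivity -/

/-- `G.IsWalk x w y`: the list `w = [(e₁, x₁), …, (eₙ, xₙ)]` is a walk `x e₁ x₁ e₂ … eₙ xₙ` of `G`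
from `x` to `y = xₙ` (with `y = x` if the list is empty). -/
inductive IsWalk {α β : Type} (G : Graph α β) : α → List (β × α) → α → Prop
  | nil {x : α} (hx : x ∈ V(G)) : IsWalk G x [] x
  | cons {x y z : α} {e : β} {w : List (β × α)} (h : G.IsLink e x y) (hw : IsWalk G y w z) :
      IsWalk G x ((e, y) :: w) z

/-- A path is a walk without repeated vertices. -/
def IsPath {α β : Type} (G : Graph α β) (x : α) (w : List (β × α)) (y : α) : Prop :=
  G.IsWalk x w y ∧ (x :: w.map Prod.snd).Nodup

/-- `G` has a vertex, and any two of its vertices are joined by a walk. -/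
def IsConnected {α β : Type} (G : Graph α β) : Prop :=
  V(G).Nonempty ∧ ∀ x ∈ V(G), ∀ y ∈ V(G), ∃ w, G.IsWalk x w y

/-- `k`-connectivity: more than `k` vertices, and the deletion of any set of fewer than `k`
vertices leaves a connected graph. -/
def IsKConnected {α β : Type} (G : Graph α β) (k : ℕ) : Prop :=
  (k : ℕ∞) < V(G).encard ∧ ∀ X ⊆ V(G), X.encard < k → (G.deleteVerts X).IsConnected

/-- Every vertex is incident with at most three edges, counting multiplicities
(for loopless graphs). -/
def IsSubcubic {α β : Type} (G : Graph α β) : Prop :=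
  ∀ v ∈ V(G), (G.incidenceSet v).encard ≤ 3

/-- `G` has a drawing in the plane: vertices are distinct points, every edge is an arc between its
ends, and the interior of an arc contains no vertex and no point of any other arc. -/
def IsPlanar {α β : Type} (G : Graph α β) : Prop :=
  ∃ (p : α → ℝ × ℝ) (γ : β → ℝ → ℝ × ℝ),
    Set.InjOn p V(G) ∧
    (∀ e ∈ E(G), ContinuousOn (γ e) (Set.Icc 0 1) ∧ Set.InjOn (γ e) (Set.Ioo 0 1) ∧
      ∃ x y, G.IsLink e x y ∧ γ e 0 = p x ∧ γ e 1 = p y) ∧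
    (∀ e ∈ E(G), ∀ t ∈ Set.Ioo (0 : ℝ) 1, ∀ v ∈ V(G), γ e t ≠ p v) ∧
    (∀ e ∈ E(G), ∀ e' ∈ E(G), e ≠ e' →
      Disjoint (γ e '' Set.Ioo 0 1) (γ e' '' Set.Ioo 0 1))

/-! ### Immersions -/

/-- `(φ, ψ)` is an `H`-immersion model in `G`: `φ` is an injection of the vertices, `ψ` sends every
edge of `H` with ends `u`, `v` to a path of `G` between `φ u` and `φ v`, and distinct edges are sent
to edge-disjoint paths. -/
def IsImmersionModel {α' β' α β : Type} (H : Graph α' β') (G : Graph α β)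
    (φ : V(H) → V(G)) (ψ : E(H) → List (β × α)) : Prop :=
  Function.Injective φ ∧
  (∀ e : E(H), ∃ u v : V(H), H.IsLink e u v ∧ G.IsPath (φ u) (ψ e) (φ v)) ∧
  (∀ e e' : E(H), e ≠ e' → List.Disjoint ((ψ e).map Prod.fst) ((ψ e').map Prod.fst))

/-- `G` contains `H` as an immersion. -/
def ContainsImmersion {α' β' α β : Type} (H : Graph α' β') (G : Graph α β) : Prop :=
  ∃ (φ : V(H) → V(G)) (ψ : E(H) → List (β × α)), IsImmersionModel H G φ ψ

end Graph

/-! ### Packings, covers and the Erdős–Pósa property -/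

namespace ErdosPosa

open Graph

/-- A class of graphs. -/
def GraphClass : Type 1 := ∀ (α β : Type), Graph α β → Prop

/-- The class `I(H)` of all finite loopless graphs that contain `H` as an immersion. -/
def immersionClass {α' β' : Type} (H : Graph α' β') : GraphClass :=
  fun _ _ G => G.IsFiniteLoopless ∧ ContainsImmersion H G

/-- `M` is isomorphic to a graph in the class `C`. -/
def IsoToMember (C : GraphClass) {α β : Type} (M : Graph α β) : Prop :=
  ∃ (α' β' : Type) (M' : Graph α' β'), C α' β' M' ∧ M.IsIsomorphic M'

/-- `G` has a `C`-vertex packing of size `k`: `k` pairwise vertex-disjoint subgraphs, each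
isomorphic to a graph in `C`. -/
def HasVertexPacking (C : GraphClass) {α β : Type} (G : Graph α β) (k : ℕ) : Prop :=
  ∃ P : Finset (Graph α β), P.card = k ∧ (∀ M ∈ P, M ≤ G ∧ IsoToMember C M) ∧
    ∀ M ∈ P, ∀ N ∈ P, M ≠ N → Disjoint V(M) V(N)

/-- `G` has a `C`-edge packing of size `k`: `k` pairwise edge-disjoint subgraphs, each
isomorphic to a graph in `C`. -/
def HasEdgePacking (C : GraphClass) {α β : Type} (G : Graph α β) (k : ℕ) : Prop :=
  ∃ P : Finset (Graph α β), P.card = k ∧ (∀ M ∈ P, M ≤ G ∧ IsoToMember C M) ∧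
    ∀ M ∈ P, ∀ N ∈ P, M ≠ N → Disjoint E(M) E(N)

/-- `G` has a `C`-vertex cover of size at most `n`: a set `S` of at most `n` vertices such that
every subgraph of `G` isomorphic to a graph in `C` contains a vertex of `S`. -/
def HasVertexCover (C : GraphClass) {α β : Type} (G : Graph α β) (n : ℕ) : Prop :=
  ∃ S : Finset α, (S : Set α) ⊆ V(G) ∧ S.card ≤ n ∧
    ∀ M : Graph α β, M ≤ G → IsoToMember C M → ∃ v ∈ S, v ∈ V(M)

/-- `G` has a `C`-edge cover of size at most `n`: a set `S` of at most `n` edges such that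
every subgraph of `G` isomorphic to a graph in `C` contains an edge of `S`. -/
def HasEdgeCover (C : GraphClass) {α β : Type} (G : Graph α β) (n : ℕ) : Prop :=
  ∃ S : Finset β, (S : Set β) ⊆ E(G) ∧ S.card ≤ n ∧
    ∀ M : Graph α β, M ≤ G → IsoToMember C M → ∃ e ∈ S, e ∈ E(M)

/-- `C` has the vertex Erdős–Pósa property. -/
def HasVertexErdosPosaProperty (C : GraphClass) : Prop :=
  ∃ f : ℕ → ℕ, ∀ (α β : Type) (G : Graph α β), G.IsFiniteLoopless → ∀ k : ℕ,
    HasVertexPacking C G k ∨ HasVertexCover C G (f k)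

/-- `C` has the edge Erdős–Pósa property. -/
def HasEdgeErdosPosaProperty (C : GraphClass) : Prop :=
  ∃ f : ℕ → ℕ, ∀ (α β : Type) (G : Graph α β), G.IsFiniteLoopless → ∀ k : ℕ,
    HasEdgePacking C G k ∨ HasEdgeCover C G (f k)

end ErdosPosa

/-! The graph `BlownK4.graph` is `K₄` with three of its vertices replaced by fat triangles; the
fourth vertex is the hub. The host `Wall.graph m` is a cubic wall with `m` triangle gadgets of type
`0` on its left side, `m` of type `1` on its right side and `m` of type `2` at the bottom. Every
gadget vertex has exactly one edge into the wall.

Gadgets and single wall vertices are clusters, and at most three edges leave any cluster. Hence the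
ends of four parallel edges of `H` must be mapped into one cluster (`cluster_eq_of_four_le`). As
each fat triangle has two such sides, it occupies a whole gadget. The three triangles have the same
number of edges but different degree sequences, so the gadget has the type of the triangle
(`exists_gad`).

No two such subgraphs are edge-disjoint, for a planar reason. Each contains a path from a left
gadget to a right one and a path from a bottom gadget to the same left gadget. These paths run
through heavy clusters, left by at least two edges of the subgraph; since three edges are too few
for two disjoint pairs, edge-disjoint subgraphs have disjoint heavy sets. A discrete Jordan argument
(`Lattice.lt_of_disjoint`) then shows that the left-right path of either subgraph cannot start in a
lower gadget than the left-bottom path of the other. So both use the same left gadget, which would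
be heavy for both, a contradiction (`not_disjoint_edgeSet`). The spokes at the hub matter here only
through the degree count.

Covers are large because three consecutive rows together with six consecutive columns already
contain `H` (`isoToMember_strip`). With `m = n + 1`, any `n` vertices miss one of the row strips and
one of the column strips. -/

namespace Graph

/-! ### Walks, paths and edge cuts in multigraphs. -/

variable {α β α' β' : Type}

/-- The graph with vertex set `V` and edge set `E` in which `e ∈ E` joins `s e` and `t e`. -/
def ofEnds (V : Set α) (E : Set β) (s t : β → α) (hV : ∀ e ∈ E, s e ∈ V ∧ t e ∈ V) :
    Graph α β where
  vertexSet := V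
  edgeSet := E
  IsLink e x y := e ∈ E ∧ ((x = s e ∧ y = t e) ∨ (x = t e ∧ y = s e))
  isLink_symm := fun e _ ↦ ⟨fun x y h ↦ ⟨h.1, h.2.symm.imp And.symm And.symm⟩⟩
  eq_or_eq_of_isLink_of_isLink := by
    rintro e x y v w ⟨-, h | h⟩ ⟨-, h' | h'⟩ <;> simp [h, h']
  edge_mem_iff_exists_isLink := fun e ↦
    ⟨fun h ↦ ⟨s e, t e, h, .inl ⟨rfl, rfl⟩⟩, fun ⟨_, _, h, _⟩ ↦ h⟩
  left_mem_of_isLink := by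
    rintro e x y ⟨he, h | h⟩
    · exact h.1 ▸ (hV e he).1
    · exact h.1 ▸ (hV e he).2

lemma ofEnds_loopless {V : Set α} {E : Set β} {s t : β → α} (hV : ∀ e ∈ E, s e ∈ V ∧ t e ∈ V)
    (h : ∀ e ∈ E, s e ≠ t e) : (ofEnds V E s t hV).Loopless := by
  refine ⟨fun e x hx ↦ ?_⟩
  obtain ⟨he, ⟨h1, h2⟩ | ⟨h1, h2⟩⟩ := hx
  · exact h e he (h1.symm.trans h2)
  · exact h e he (h2.symm.trans h1)

variable {G : Graph α β}

lemma IsWalk.left_mem {x y : α} {w : List (β × α)} (h : G.IsWalk x w y) : x ∈ V(G) := by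
  cases h with
  | nil hx => exact hx
  | cons h _ => exact h.left_mem

lemma IsWalk.append {x y z : α} {w w' : List (β × α)} (h : G.IsWalk x w y)
    (h' : G.IsWalk y w' z) : G.IsWalk x (w ++ w') z := by
  induction h with
  | nil hx => exact h'
  | cons h _ ih => exact .cons h (ih h')

/-- A walk through a vertex `z` can be split at `z`. -/
lemma IsWalk.exists_append {x y z : α} {w : List (β × α)} (h : G.IsWalk x w y)
    (hz : z ∈ x :: w.map Prod.snd) :
    ∃ w₁ w₂, w = w₁ ++ w₂ ∧ G.IsWalk x w₁ z ∧ G.IsWalk z w₂ y ∧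
      z :: w₂.map Prod.snd <:+ x :: w.map Prod.snd := by
  induction h with
  | @nil x hx =>
    obtain rfl : z = x := by simpa using hz
    exact ⟨[], [], rfl, .nil hx, .nil hx, List.suffix_rfl⟩
  | @cons x y' y e w h hw ih =>
    by_cases hzx : z = x
    · subst hzx
      exact ⟨[], _, rfl, .nil h.left_mem, .cons h hw, List.suffix_rfl⟩
    · obtain ⟨w₁, w₂, rfl, h₁, h₂, h₃⟩ := ih (by simpa [hzx] using hz)
      exact ⟨(e, y') :: w₁, w₂, rfl, .cons h h₁, h₂, h₃.trans (List.suffix_cons _ _)⟩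

/-- A walk that enters a set `K` uses an edge with exactly one end in `K`. -/
lemma IsWalk.exists_boundary {x y : α} {w : List (β × α)} (h : G.IsWalk x w y) {K : Set α}
    (hK : ¬ (x ∈ K ↔ y ∈ K)) :
    ∃ e ∈ w.map Prod.fst, ∃ u v, G.IsLink e u v ∧ u ∈ K ∧ v ∉ K := by
  induction h with
  | nil hx => exact absurd Iff.rfl hK
  | @cons x y' y e w h hw ih =>
    by_cases hy : (x ∈ K ↔ y' ∈ K)
    · obtain ⟨f, hf, hf'⟩ := ih (by rwa [← hy])
      exact ⟨f, by simp only [List.map_cons, List.mem_cons]; exact .inr hf, hf'⟩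
    · refine ⟨e, by simp, ?_⟩
      by_cases hx : x ∈ K
      · exact ⟨x, y', h, hx, fun h' ↦ hy (by simp [hx, h'])⟩
      · exact ⟨y', x, h.symm, by by_contra h'; exact hy (by simp [hx, h']), hx⟩

lemma IsWalk.mem_of_edge {x y u v : α} {e : β} {w : List (β × α)} (h : G.IsWalk x w y)
    (he : e ∈ w.map Prod.fst) (hl : G.IsLink e u v) : u ∈ x :: w.map Prod.snd := by
  induction h with
  | nil hx => simp at he
  | @cons x y' y f w h hw ih =>
    simp only [List.map_cons, List.mem_cons] at he ⊢
    obtain rfl | he := he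
    · obtain rfl | rfl := hl.left_eq_or_eq h <;> simp
    · have := ih he
      simp only [List.mem_cons] at this
      tauto

/-- The edges of a path are distinct. -/
lemma IsPath.nodup_edges {x y : α} {w : List (β × α)} (h : G.IsPath x w y) :
    (w.map Prod.fst).Nodup := by
  obtain ⟨h, hn⟩ := h
  induction h with
  | nil hx => simp
  | @cons x y' y e w h hw ih =>
    simp only [List.map_cons, List.nodup_cons] at hn ⊢
    refine ⟨fun he ↦ hn.1 ?_, ih (by simpa using hn.2)⟩
    simpa using hw.mem_of_edge he h

/-- Every walk contains a path with the same ends. -/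
lemma IsWalk.exists_isPath {x y : α} {w : List (β × α)} (h : G.IsWalk x w y) :
    ∃ w', G.IsPath x w' y ∧ w' ⊆ w := by
  induction h with
  | nil hx => exact ⟨[], ⟨.nil hx, by simp⟩, by simp⟩
  | @cons x y' y e w h hw ih =>
    obtain ⟨w', ⟨h1, h2⟩, h3⟩ := ih
    by_cases hx : x ∈ y' :: w'.map Prod.snd
    · obtain ⟨w₁, w₂, rfl, -, hw₂, hs⟩ := h1.exists_append hx
      exact ⟨w₂, ⟨hw₂, h2.sublist hs.sublist⟩,
        fun a ha ↦ by simp [h3 (List.mem_append_right _ ha)]⟩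
    · refine ⟨(e, y') :: w', ⟨.cons h h1, ?_⟩, by simpa using List.Subset.trans h3 (by simp)⟩
      simpa using ⟨by simpa using hx, by simpa using h2⟩

/-- A path with both ends outside `K` that meets `K` uses two edges with exactly one end in `K`. -/
lemma IsPath.exists_two_boundary {x y z : α} {w : List (β × α)} (h : G.IsPath x w y) {K : Set α}
    (hx : x ∉ K) (hy : y ∉ K) (hz : z ∈ x :: w.map Prod.snd) (hzK : z ∈ K) :
    ∃ e ∈ w.map Prod.fst, ∃ f ∈ w.map Prod.fst, e ≠ f ∧
      (∃ u v, G.IsLink e u v ∧ u ∈ K ∧ v ∉ K) ∧ (∃ u v, G.IsLink f u v ∧ u ∈ K ∧ v ∉ K) := by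
  have hn := h.nodup_edges
  obtain ⟨w₁, w₂, rfl, h₁, h₂, -⟩ := h.1.exists_append hz
  obtain ⟨e, he, he'⟩ := h₁.exists_boundary (K := K) (by tauto)
  obtain ⟨f, hf, hf'⟩ := h₂.exists_boundary (K := K) (by tauto)
  rw [List.map_append] at hn
  refine ⟨e, by simp_all, f, by simp_all, ?_, he', hf'⟩
  rintro rfl
  exact List.disjoint_of_nodup_append hn he hf

/-- `x` and `y` are joined by a walk all of whose edges belong to `S`. -/
def Linked (G : Graph α β) (S : Set β) (x y : α) : Prop :=
  ∃ w, G.IsWalk x w y ∧ ∀ e ∈ w.map Prod.fst, e ∈ S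

namespace Linked

variable {S T : Set β} {x y z : α}

lemma refl (hx : x ∈ V(G)) : G.Linked S x x := ⟨[], .nil hx, by simp⟩

lemma of_isLink {e : β} (h : G.IsLink e x y) (he : e ∈ S) : G.Linked S x y :=
  ⟨[(e, y)], .cons h (.nil h.right_mem), by simpa using he⟩

lemma trans (h : G.Linked S x y) (h' : G.Linked S y z) : G.Linked S x z := by
  obtain ⟨w, hw, hS⟩ := h
  obtain ⟨w', hw', hS'⟩ := h'
  refine ⟨w ++ w', hw.append hw', fun e he ↦ ?_⟩
  rw [List.map_append, List.mem_append] at he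
  exact he.elim (hS e) (hS' e)

lemma symm (h : G.Linked S x y) : G.Linked S y x := by
  obtain ⟨w, hw, hS⟩ := h
  induction hw with
  | nil hx => exact refl hx
  | cons h hw ih =>
    exact (ih fun e he ↦ hS e (List.mem_cons_of_mem _ he)).trans
      (of_isLink h.symm (hS _ (by simp)))

lemma mono (h : G.Linked S x y) (hST : S ⊆ T) : G.Linked T x y := by
  obtain ⟨w, hw, hS⟩ := h
  exact ⟨w, hw, fun e he ↦ hST (hS e he)⟩

lemma exists_isPath (h : G.Linked S x y) :
    ∃ w, G.IsPath x w y ∧ ∀ e ∈ w.map Prod.fst, e ∈ S := by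
  obtain ⟨w, hw, hS⟩ := h
  obtain ⟨w', hw', h'⟩ := hw.exists_isPath
  exact ⟨w', hw', fun e he ↦ hS e (List.map_subset _ h' he)⟩

/-- Edge sets linking a vertex of `K` to a vertex outside `K` contain an edge leaving `K`. -/
lemma exists_boundary (h : G.Linked S x y) {K : Set α} (hK : ¬ (x ∈ K ↔ y ∈ K)) :
    ∃ e ∈ S, ∃ u v, G.IsLink e u v ∧ u ∈ K ∧ v ∉ K := by
  obtain ⟨w, hw, hS⟩ := h
  obtain ⟨e, he, h⟩ := hw.exists_boundary hK
  exact ⟨e, hS e he, h⟩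

end Linked

/-! ### Immersions as families of disjoint linking edge sets. -/

/-- `H` is an immersion in the subgraph `M` of `G`: the vertices of `H` are mapped injectively, and
the edges of `H` are sent to disjoint sets of edges of `M` linking the images of their ends. -/
def HasImmersionIn (H : Graph α' β') (G M : Graph α β) (φ : α' → α) (S : β' → Set β) : Prop :=
  Set.InjOn φ V(H) ∧ (∀ e ∈ E(H), S e ⊆ E(M)) ∧
  (∀ e ∈ E(H), ∀ e' ∈ E(H), e ≠ e' → Disjoint (S e) (S e')) ∧
  ∀ e u v, H.IsLink e u v → G.Linked (S e) (φ u) (φ v)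

/-- Disjoint edge sets suffice, because a walk inside one of them shortens to a path inside it. -/
lemma containsImmersion_of_linked {H : Graph α' β'} (φ : α' → α) (S : β' → Set β)
    (hφ : Set.InjOn φ V(H)) (hV : ∀ v ∈ V(H), φ v ∈ V(G))
    (hS : ∀ e ∈ E(H), ∀ e' ∈ E(H), e ≠ e' → Disjoint (S e) (S e'))
    (hl : ∀ e ∈ E(H), ∃ u v, H.IsLink e u v ∧ G.Linked (S e) (φ u) (φ v)) :
    ContainsImmersion H G := by
  have key : ∀ e : E(H), ∃ (w : List (β × α)), (∀ f ∈ w.map Prod.fst, f ∈ S e) ∧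
      ∃ u v : V(H), H.IsLink e u v ∧ G.IsPath (φ u) w (φ v) := by
    rintro ⟨e, he⟩
    obtain ⟨u, v, huv, h⟩ := hl e he
    obtain ⟨w, hw, h'⟩ := h.exists_isPath
    exact ⟨w, h', ⟨u, huv.left_mem⟩, ⟨v, huv.right_mem⟩, huv, hw⟩
  choose ψ h1 h2 using key
  refine ⟨fun v ↦ ⟨φ v, hV v v.2⟩, ψ, fun u v h ↦ ?_, h2, fun e e' hne f hf hf' ↦ ?_⟩
  · exact Subtype.ext (hφ u.2 v.2 (congrArg Subtype.val h))
  · exact Set.disjoint_left.1 (hS e e.2 e' e'.2 fun h ↦ hne (Subtype.ext h)) (h1 e f hf)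
      (h1 e' f hf')

lemma IsIsomorphic.refl (G : Graph α β) : G.IsIsomorphic G :=
  ⟨Equiv.refl _, Equiv.refl _, fun _ _ _ ↦ Iff.rfl⟩

/-- Pulling the model back along the isomorphism edge by edge lets all later arguments take place in
`G` itself, with total maps in place of maps on subtypes. -/
lemma exists_hasImmersionIn {H : Graph α' β'} {M : Graph α β} (hM : M ≤ G)
    (h : ErdosPosa.IsoToMember (ErdosPosa.immersionClass H) M) (hne : V(H).Nonempty) :
    ∃ φ S, HasImmersionIn H G M φ S ∧ ∀ v ∈ V(H), φ v ∈ V(M) := by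
  classical
  obtain ⟨α₁, β₁, M', ⟨-, φ, ψ, hφ, hψ, hd⟩, f, g, hfg⟩ := h
  have : Nonempty α := ⟨(f.symm (φ ⟨_, hne.choose_spec⟩)).1⟩
  let φ' : α' → α := fun v ↦ if h : v ∈ V(H) then f.symm (φ ⟨v, h⟩) else Classical.arbitrary α
  have hφ' : ∀ v : V(H), φ' v = f.symm (φ v) := fun v ↦ by simp [φ']
  let S : β' → Set β := fun e ↦
    {b | ∃ (he : e ∈ E(H)) (hb : b ∈ E(M)), (g ⟨b, hb⟩).1 ∈ (ψ ⟨e, he⟩).map Prod.fst}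
  have lift : ∀ {T : Set β₁} {x y : α₁} (w), M'.IsWalk x w y → (∀ e ∈ w.map Prod.fst, e ∈ T) →
      ∃ (hx : x ∈ V(M')) (hy : y ∈ V(M')),
        G.Linked {b | ∃ hb : b ∈ E(M), (g ⟨b, hb⟩).1 ∈ T} (f.symm ⟨x, hx⟩) (f.symm ⟨y, hy⟩) := by
    intro T x y w hw hT
    induction hw with
    | nil hx => exact ⟨hx, hx, .refl (hM.vertexSet_mono (f.symm ⟨_, hx⟩).2)⟩
    | @cons x y z e w h hw ih =>
      obtain ⟨hy, hz, ih⟩ := ih fun e he ↦ hT e (List.mem_cons_of_mem _ he)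
      refine ⟨h.left_mem, hz, .trans (.of_isLink (e := (g.symm ⟨e, h.edge_mem⟩).1) ?_ ?_) ih⟩
      · refine IsLink.mono hM ((hfg _ _ _).2 ?_)
        simpa using h
      · exact ⟨(g.symm ⟨e, h.edge_mem⟩).2, by simpa using hT e (by simp)⟩
  refine ⟨φ', S, ⟨?_, ?_, ?_, ?_⟩, fun v hv ↦ ?_⟩
  · intro u hu v hv h
    rw [hφ' ⟨u, hu⟩, hφ' ⟨v, hv⟩] at h
    exact congrArg Subtype.val (hφ (f.symm.injective (Subtype.ext h)))
  · exact fun e he b hb ↦ hb.2.1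
  · intro e he e' he' hne
    refine Set.disjoint_left.2 fun b ⟨_, hb, h1⟩ ⟨_, _, h2⟩ ↦ ?_
    exact hd ⟨e, he⟩ ⟨e', he'⟩ (fun h ↦ hne (congrArg Subtype.val h)) h1 h2
  · have key : ∀ e u v, H.IsLink e u v → (∃ w, (∀ b ∈ w.map Prod.fst,
        ∃ he : e ∈ E(H), b ∈ (ψ ⟨e, he⟩).map Prod.fst) ∧
        ∃ hu hv, M'.IsWalk (φ ⟨u, hu⟩) w (φ ⟨v, hv⟩)) → G.Linked (S e) (φ' u) (φ' v) := by
      rintro e u v he ⟨w, hw, hu, hv, h⟩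
      obtain ⟨_, _, hl⟩ := lift w h hw
      rw [hφ' ⟨u, hu⟩, hφ' ⟨v, hv⟩]
      refine hl.mono fun b ⟨hb, he, h⟩ ↦ ⟨he, hb, h⟩
    intro e u v he
    obtain ⟨u', v', hl, hp, -⟩ := hψ ⟨e, he.edge_mem⟩
    have := key e u' v' hl ⟨ψ ⟨e, he.edge_mem⟩, fun b hb ↦ ⟨he.edge_mem, hb⟩, u'.2, v'.2, hp⟩
    obtain ⟨rfl, rfl⟩ | ⟨rfl, rfl⟩ := he.eq_and_eq_or_eq_and_eq hl
    · exact this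
    · exact this.symm
  · rw [hφ' ⟨v, hv⟩]
    exact (f.symm _).2

/-- The number of edges of `H` with exactly one end mapped into `K` is at most the number of edges
of `G` leaving `K`. -/
lemma HasImmersionIn.card_le_boundary {H : Graph α' β'} {M : Graph α β} {φ : α' → α}
    {S : β' → Set β} (h : HasImmersionIn H G M φ S) {K : Set α} {F : Finset β'} {B : Finset β}
    (hF : ∀ e ∈ F, ∃ u v, H.IsLink e u v ∧ φ u ∈ K ∧ φ v ∉ K)
    (hB : ∀ e u v, G.IsLink e u v → u ∈ K → v ∉ K → e ∈ E(M) → e ∈ B) : F.card ≤ B.card := by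
  have key : ∀ e ∈ F, ∃ b, b ∈ S e ∧ b ∈ B := by
    intro e he
    obtain ⟨u, v, huv, hu, hv⟩ := hF e he
    obtain ⟨b, hb, x, y, hxy, hx, hy⟩ := (h.2.2.2 e u v huv).exists_boundary (K := K) (by tauto)
    exact ⟨b, hb, hB b x y hxy hx hy (h.2.1 e huv.edge_mem hb)⟩
  have hE : ∀ e ∈ F, e ∈ E(H) := fun e he ↦ by
    obtain ⟨u, v, huv, -⟩ := hF e he
    exact huv.edge_mem
  obtain rfl | ⟨e₀, he₀⟩ := F.eq_empty_or_nonempty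
  · simp
  have : Nonempty β := ⟨(key e₀ he₀).choose⟩
  choose! b hb using key
  refine Finset.card_le_card_of_injOn b (fun e he ↦ (hb e he).2) fun e he e' he' hee ↦ ?_
  by_contra hne
  exact Set.disjoint_left.1 (h.2.2.1 e (hE e he) e' (hE e' he') hne) (hb e he).1
    (hee ▸ (hb e' he').1)

end Graph

namespace Graph.BlownK4

/-- Vertices of the blown-up `K₄`: the vertices `(t, r)` of three fat triangles, and a hub. -/
abbrev Vert : Type := Option (Fin 3 × Fin 3)

/-- Bundles of parallel edges: `(t, 0)`, `(t, 1)`, `(t, 2)` are the sides of the fat triangle `t`,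
`(t, 3)` joins it to the hub and `(t, 4)` joins it to the triangle `t + 1`. -/
abbrev Bundle : Type := Fin 3 × Fin 5

/-- The multiplicity of the sides of the fat triangles. -/
def mult (t s : Fin 3) : ℕ := ![![4, 4, 3], ![4, 5, 2], ![5, 5, 1]] t s

/-- The first end of a side of a triangle. -/
def sideFst (s : Fin 3) : Fin 3 := ![0, 1, 0] s

/-- The second end of a side of a triangle. -/
def sideSnd (s : Fin 3) : Fin 3 := ![1, 2, 2] s

/-- A side of a fat triangle as an index of a bundle. -/
def sideBundle (s : Fin 3) : Fin 5 := s.castLE (by decide)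

/-- The multiplicity of a bundle. -/
def bundleMult (b : Bundle) : ℕ := ![mult b.1 0, mult b.1 1, mult b.1 2, 1, 1] b.2

/-- The first end of a bundle. -/
def fst (b : Bundle) : Vert := some (b.1, ![0, 1, 0, 1, 2] b.2)

/-- The second end of a bundle. -/
def snd (b : Bundle) : Vert :=
  ![some (b.1, 1), some (b.1, 2), some (b.1, 2), none, some (b.1 + 1, 0)] b.2

/-- `K₄` with three of its vertices replaced by fat triangles. -/
def graph : Graph Vert (Bundle × ℕ) :=
  ofEnds Set.univ {e | e.2 < bundleMult e.1} (fun e ↦ fst e.1) (fun e ↦ snd e.1) (by simp)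

lemma fst_ne_snd : ∀ b, fst b ≠ snd b := by decide

lemma mem_edgeSet {e : Bundle × ℕ} : e ∈ E(graph) ↔ e.2 < bundleMult e.1 := Iff.rfl

lemma isLink {e : Bundle × ℕ} (he : e.2 < bundleMult e.1) :
    graph.IsLink e (fst e.1) (snd e.1) := ⟨he, .inl ⟨rfl, rfl⟩⟩

lemma bundleMult_le : ∀ b, bundleMult b ≤ 5 := by decide

lemma bundleMult_pos : ∀ b, 0 < bundleMult b := by decide

lemma isFiniteLoopless : graph.IsFiniteLoopless := by
  refine ⟨Set.toFinite _, ?_, ofEnds_loopless _ fun e _ ↦ fst_ne_snd e.1⟩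
  refine ((Finset.univ ×ˢ Finset.range 5 : Finset (Bundle × ℕ)).finite_toSet).subset
    fun e he ↦ ?_
  simpa using (mem_edgeSet.1 he).trans_le (bundleMult_le _)

lemma not_isSubcubic : ¬ graph.IsSubcubic := by
  intro h
  have h := h (some (0, 0)) (Set.mem_univ _)
  have h' : (((Finset.range 4).map ⟨fun i ↦ (((0, 0), i) : Bundle × ℕ),
      fun i j hij ↦ by simpa using hij⟩ : Finset (Bundle × ℕ)) : Set (Bundle × ℕ)) ⊆
      graph.incidenceSet (some (0, 0)) := by
    intro e he
    obtain ⟨i, hi, rfl⟩ : ∃ i < 4, (((0, 0), i) : Bundle × ℕ) = e := by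
      rw [Finset.mem_coe, Finset.mem_map] at he
      obtain ⟨i, hi, rfl⟩ := he
      exact ⟨i, Finset.mem_range.1 hi, rfl⟩
    exact ⟨_, isLink (e := ((0, 0), i)) hi⟩
  have h2 := (Set.encard_le_encard h').trans h
  rw [Set.encard_coe_eq_coe_finsetCard, Finset.card_map, Finset.card_range] at h2
  exact absurd h2 (by decide)

/-- The neighbours of a vertex. -/
def nbrs : Vert → List Vert
  | none => [some (0, 1), some (1, 1), some (2, 1)]
  | some (t, 0) => [some (t, 1), some (t, 2), some (t - 1, 2)]
  | some (t, 1) => [some (t, 0), some (t, 2), none]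
  | some (t, 2) => [some (t, 0), some (t, 1), some (t + 1, 0)]

/-- Whether `r` can be reached from `v` in at most `n` steps that avoid `a` and `b`. -/
def reach (a b r : Vert) : ℕ → Vert → Bool
  | 0, v => v == r
  | n + 1, v => v == r || (nbrs v).any fun u ↦ !(u == a) && !(u == b) && reach a b r n u

lemma exists_link_of_mem_nbrs : ∀ v, ∀ u ∈ nbrs v, ∃ e : Bundle × ℕ, graph.IsLink e v u := by
  have key : ∀ v, ∀ u ∈ nbrs v, ∃ b, (v = fst b ∧ u = snd b) ∨ (v = snd b ∧ u = fst b) := by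
    decide
  intro v u hu
  obtain ⟨b, hb⟩ := key v u hu
  exact ⟨(b, 0), bundleMult_pos b, hb⟩

/-- The search avoids both `a` and `b`, so its walk survives the deletion of any subset of `{a, b}`.
This treats deletions of zero, one and two vertices at once. -/
lemma linked_of_reach {a b r : Vert} {X : Set Vert} (hX : X ⊆ {a, b}) :
    ∀ (n : ℕ) {v : Vert}, v ≠ a → v ≠ b → reach a b r n v = true →
      (graph.deleteVerts X).Linked Set.univ v r := by
  have hmem : ∀ v, v ≠ a → v ≠ b → v ∉ X := fun v h1 h2 h ↦ (hX h).elim h1 h2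
  intro n
  induction n with
  | zero =>
    intro v ha hb hv
    obtain rfl : v = r := by simpa [reach] using hv
    exact .refl ⟨Set.mem_univ _, hmem v ha hb⟩
  | succ n ih =>
    intro v ha hb hv
    simp only [reach, Bool.or_eq_true, beq_iff_eq, List.any_eq_true, Bool.and_eq_true,
      Bool.not_eq_true', beq_eq_false_iff_ne] at hv
    obtain rfl | ⟨u, hu, ⟨hua, hub⟩, hur⟩ := hv
    · exact .refl ⟨Set.mem_univ _, hmem v ha hb⟩
    · obtain ⟨e, he⟩ := exists_link_of_mem_nbrs v u hu
      refine .trans (.of_isLink (e := e) ?_ (Set.mem_univ _)) (ih hua hub hur)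
      exact (deleteVerts_isLink ..).2 ⟨he, hmem v ha hb, hmem u hua hub⟩

lemma exists_reach : ∀ a b : Vert, ∃ r, r ≠ a ∧ r ≠ b ∧
    ∀ v, v ≠ a → v ≠ b → reach a b r 5 v = true := by
  decide +kernel

lemma exists_mem_nbrs_ne : ∀ v a b : Vert, ∃ u ∈ nbrs v, u ≠ a ∧ u ≠ b := by
  decide +kernel

lemma isKConnected : graph.IsKConnected 3 := by
  constructor
  · have h : V(graph) = Set.univ := rfl
    rw [h, Set.encard_univ, ENat.card_eq_coe_fintype_card]
    exact_mod_cast (by decide : 3 < Fintype.card Vert)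
  · intro X _ hX
    obtain ⟨a, b, hab⟩ : ∃ a b, X ⊆ {a, b} := by
      have h2 : X.encard ≤ 2 := Order.le_of_lt_add_one hX
      obtain h | h := h2.lt_or_eq
      · obtain rfl | ⟨a, rfl⟩ := Set.encard_le_one_iff_eq.1 (Order.le_of_lt_add_one h)
        · exact ⟨none, none, by simp⟩
        · exact ⟨a, a, by simp⟩
      · obtain ⟨a, b, -, rfl⟩ := Set.encard_eq_two.1 h
        exact ⟨a, b, subset_rfl⟩
    obtain ⟨r, ha, hb, h⟩ := exists_reach a b
    have key : ∀ v ∈ V(graph.deleteVerts X), (graph.deleteVerts X).Linked Set.univ v r := by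
      intro v hv
      -- When `X` is a proper subset of `{a, b}`, a surviving `v` may equal `a` or `b`; it is then
      -- attached through a neighbour outside `{a, b}`.
      by_cases hva : v ≠ a ∧ v ≠ b
      · exact linked_of_reach hab 5 hva.1 hva.2 (h v hva.1 hva.2)
      · obtain ⟨u, hu, hua, hub⟩ := exists_mem_nbrs_ne v a b
        obtain ⟨e, he⟩ := exists_link_of_mem_nbrs v u hu
        refine .trans (.of_isLink (e := e) ?_ (Set.mem_univ _))
          (linked_of_reach hab 5 hua hub (h u hua hub))
        exact (deleteVerts_isLink ..).2 ⟨he, hv.2, fun hu ↦ (hab hu).elim hua hub⟩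
    refine ⟨⟨r, Set.mem_univ _, fun hr ↦ (hab hr).elim ha hb⟩, fun x hx y hy ↦ ?_⟩
    obtain ⟨w, hw, -⟩ := (key x hx).trans (key y hy).symm
    exact ⟨w, hw⟩

end Graph.BlownK4

/-! ### A plane drawing by parabolic arcs. -/

namespace Graph.BlownK4

/-- The positions of the vertices in a plane drawing. -/
def pos : Vert → ℤ × ℤ
  | none => (0, 0)
  | some (t, r) =>
    ![![(-14, 4), (-8, 4), (-10, 10)], ![(10, 10), (8, 4), (14, 4)],
      ![(4, -12), (0, -6), (-4, -12)]] t r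

/-- The direction in which the edges of a bundle are bent. -/
def bend (b : Bundle) : ℤ × ℤ :=
  if |(pos (snd b)).1 - (pos (fst b)).1| ≤ |(pos (snd b)).2 - (pos (fst b)).2| then (1, 0)
  else (0, 1)

/-- The arc that draws the edge `e`. -/
noncomputable def arc (e : Bundle × ℕ) (x : ℝ) : ℝ × ℝ :=
  ((1 - x) * (pos (fst e.1)).1 + x * (pos (snd e.1)).1
      + x * (1 - x) * ((e.2 + 1) / 8) * (bend e.1).1,
    (1 - x) * (pos (fst e.1)).2 + x * (pos (snd e.1)).2
      + x * (1 - x) * ((e.2 + 1) / 8) * (bend e.1).2)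

/-- The value of a linear functional with integer coefficients. -/
def lin (l p : ℤ × ℤ) : ℤ := l.1 * p.1 + l.2 * p.2

/-- The functionals that separate the arcs. -/
def dirs : List (ℤ × ℤ) := [(-1, 0), (0, 1), (0, -1), (1, 0), (-1, -1), (1, -1), (1, 1), (-1, 1)]

/-- The functional `l` is at least `m` at both ends of the bundle `b` and at the apex of the
outermost arc that the bundle may use. -/
def Above (l : ℤ × ℤ) (m : ℤ) (b : Bundle) : Prop :=
  m ≤ lin l (pos (fst b)) ∧ m ≤ lin l (pos (snd b)) ∧
    2 * m ≤ lin l (pos (fst b)) + lin l (pos (snd b)) + lin l (bend b)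

/-- `Above`, with at least one of the inequalities strict. -/
def StrictAbove (l : ℤ × ℤ) (m : ℤ) (b : Bundle) : Prop :=
  Above l m b ∧ (2 * m < lin l (pos (fst b)) + lin l (pos (snd b)) ∨
    2 * m < lin l (pos (fst b)) + lin l (pos (snd b)) + lin l (bend b))

instance (l m b) : Decidable (Above l m b) := by unfold Above; infer_instance
instance (l m b) : Decidable (StrictAbove l m b) := by unfold StrictAbove; infer_instance

/-- A functional on the plane. -/
noncomputable def linR (l : ℤ × ℤ) (p : ℝ × ℝ) : ℝ := l.1 * p.1 + l.2 * p.2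

lemma linR_arc (l : ℤ × ℤ) (e : Bundle × ℕ) (x : ℝ) :
    linR l (arc e x) = (1 - x) * lin l (pos (fst e.1)) + x * lin l (pos (snd e.1))
      + x * (1 - x) * ((e.2 + 1) / 8) * lin l (bend e.1) := by
  simp only [linR, arc, lin]
  push_cast
  ring

/-- This is the Bernstein form of a quadratic Bézier curve, with the middle coefficient split
between the straight segment and the fully bent arc. The weight `(e.2 + 1) / 8` lies strictly
between `0` and `1`, as multiplicities are at most `5`; so bounds at three control points per bundle
govern all of its arcs. -/
lemma linR_arc_sub (l : ℤ × ℤ) (m : ℤ) (e : Bundle × ℕ) (x : ℝ) :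
    linR l (arc e x) - m = (1 - x) ^ 2 * ((lin l (pos (fst e.1)) : ℝ) - m)
      + x ^ 2 * ((lin l (pos (snd e.1)) : ℝ) - m)
      + x * (1 - x) * ((1 - (e.2 + 1) / 8) *
          ((lin l (pos (fst e.1)) : ℝ) + lin l (pos (snd e.1)) - 2 * m)
        + (e.2 + 1) / 8 *
          ((lin l (pos (fst e.1)) : ℝ) + lin l (pos (snd e.1)) + lin l (bend e.1) - 2 * m)) := by
  rw [linR_arc]
  ring

lemma le_linR_arc {l : ℤ × ℤ} {m : ℤ} {e : Bundle × ℕ} (he : e ∈ E(graph))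
    (h : Above l m e.1) {x : ℝ} (hx : x ∈ Set.Ioo (0 : ℝ) 1) : (m : ℝ) ≤ linR l (arc e x) := by
  have h5 : e.2 + 1 ≤ 5 := (mem_edgeSet.1 he).trans_le (bundleMult_le _)
  have h5 : ((e.2 : ℝ) + 1) ≤ 5 := by exact_mod_cast h5
  have h0 : (0 : ℝ) ≤ e.2 := by positivity
  obtain ⟨h1, h2, h3⟩ := h
  have h1 : (0 : ℝ) ≤ (lin l (pos (fst e.1)) : ℝ) - m := by rw [sub_nonneg]; exact_mod_cast h1
  have h2 : (0 : ℝ) ≤ (lin l (pos (snd e.1)) : ℝ) - m := by rw [sub_nonneg]; exact_mod_cast h2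
  have h3 : (0 : ℝ) ≤ (lin l (pos (fst e.1)) : ℝ) + lin l (pos (snd e.1)) + lin l (bend e.1)
      - 2 * m := by rw [sub_nonneg]; exact_mod_cast h3
  rw [← sub_nonneg, linR_arc_sub]
  have := hx.1
  have := sub_pos.2 hx.2
  have h4 : (0 : ℝ) ≤ (lin l (pos (fst e.1)) : ℝ) + lin l (pos (snd e.1)) - 2 * m := by linarith
  have : (0 : ℝ) ≤ 1 - (e.2 + 1) / 8 := by linarith
  positivity

lemma lt_linR_arc {l : ℤ × ℤ} {m : ℤ} {e : Bundle × ℕ} (he : e ∈ E(graph))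
    (h : StrictAbove l m e.1) {x : ℝ} (hx : x ∈ Set.Ioo (0 : ℝ) 1) :
    (m : ℝ) < linR l (arc e x) := by
  have h5 : e.2 + 1 ≤ 5 := (mem_edgeSet.1 he).trans_le (bundleMult_le _)
  have h5 : ((e.2 : ℝ) + 1) ≤ 5 := by exact_mod_cast h5
  have h0 : (0 : ℝ) ≤ e.2 := by positivity
  obtain ⟨⟨h1, h2, h3⟩, h4⟩ := h
  have h1 : (0 : ℝ) ≤ (lin l (pos (fst e.1)) : ℝ) - m := by rw [sub_nonneg]; exact_mod_cast h1
  have h2 : (0 : ℝ) ≤ (lin l (pos (snd e.1)) : ℝ) - m := by rw [sub_nonneg]; exact_mod_cast h2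
  have h3 : (0 : ℝ) ≤ (lin l (pos (fst e.1)) : ℝ) + lin l (pos (snd e.1)) + lin l (bend e.1)
      - 2 * m := by rw [sub_nonneg]; exact_mod_cast h3
  rw [← sub_pos, linR_arc_sub]
  have := hx.1
  have := sub_pos.2 hx.2
  have h6 : (0 : ℝ) ≤ (lin l (pos (fst e.1)) : ℝ) + lin l (pos (snd e.1)) - 2 * m := by linarith
  have h7 : (0 : ℝ) < 1 - (e.2 + 1) / 8 := by linarith
  refine add_pos_of_nonneg_of_pos (by positivity) (mul_pos (by positivity) ?_)
  obtain h4 | h4 := h4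
  · have h4 : (0 : ℝ) < (lin l (pos (fst e.1)) : ℝ) + lin l (pos (snd e.1)) - 2 * m := by
      rw [sub_pos]; exact_mod_cast h4
    positivity
  · have h4 : (0 : ℝ) < (lin l (pos (fst e.1)) : ℝ) + lin l (pos (snd e.1)) + lin l (bend e.1)
        - 2 * m := by
      rw [sub_pos]; exact_mod_cast h4
    positivity

/-- The smallest control value of a bundle. -/
def low (l : ℤ × ℤ) (b : Bundle) : ℤ :=
  min (min (lin l (pos (fst b))) (lin l (pos (snd b))))
    ((lin l (pos (fst b)) + lin l (pos (snd b)) + lin l (bend b)) / 2)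

/-- The bundle `b` is separated from the bundle `b'` by a functional. -/
def Separated (b b' : Bundle) : Prop :=
  ∃ l ∈ dirs, StrictAbove l (low l b) b ∧ Above (-l) (-low l b) b'

instance (b b') : Decidable (Separated b b') := by unfold Separated; infer_instance

/-- Bundles with a common end cannot be strictly separated as closed sets; strictness on one side,
at interior parameters only, is enough. Both orders are allowed because the level is always the
least control value of the first bundle, rounded down. -/
lemma separated : ∀ b b', b ≠ b' → Separated b b' ∨ Separated b' b := by
  decide +kernel

lemma vertex_separated : ∀ b v, ∃ l ∈ dirs, StrictAbove l (lin l (pos v)) b := by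
  decide +kernel

lemma linR_neg (l : ℤ × ℤ) (p : ℝ × ℝ) : linR (-l) p = -linR l p := by
  simp [linR]
  ring

lemma Separated.arc_ne {e e' : Bundle × ℕ} (he : e ∈ E(graph)) (he' : e' ∈ E(graph))
    (h : Separated e.1 e'.1) {x y : ℝ} (hx : x ∈ Set.Ioo (0 : ℝ) 1) (hy : y ∈ Set.Ioo (0 : ℝ) 1) :
    arc e x ≠ arc e' y := by
  obtain ⟨l, -, h1, h2⟩ := h
  intro heq
  have h1 := lt_linR_arc he h1 hx
  have h2 := le_linR_arc he' h2 hy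
  rw [linR_neg, ← heq] at h2
  push_cast at h2
  linarith

/-- The bend of a bundle is not parallel to the segment between its ends. -/
lemma det_ne_zero : ∀ b, ((pos (snd b)).1 - (pos (fst b)).1) * (bend b).2
    - ((pos (snd b)).2 - (pos (fst b)).2) * (bend b).1 ≠ 0 := by
  decide +kernel

lemma bend_ne_zero :
    ∀ b, ((bend b).1, (bend b).2) = (1, 0) ∨ ((bend b).1, (bend b).2) = (0, 1) := by
  decide +kernel

/-- Arcs of the same bundle that share an interior point are equal, as are the parameters. -/
lemma arc_inj {b : Bundle} {i j : ℕ} {x y : ℝ} (hx : x ∈ Set.Ioo (0 : ℝ) 1)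
    (h : arc (b, i) x = arc (b, j) y) : x = y ∧ i = j := by
  have hd := det_ne_zero b
  have h1 := congrArg Prod.fst h
  have h2 := congrArg Prod.snd h
  simp only [arc] at h1 h2
  have hd' : (((pos (snd b)).1 : ℝ) - (pos (fst b)).1) * (bend b).2
    - (((pos (snd b)).2 : ℝ) - (pos (fst b)).2) * (bend b).1 ≠ 0 := by exact_mod_cast hd
  have hxy : x = y := by
    rw [← sub_eq_zero]
    refine (mul_eq_zero.1 ?_).resolve_right hd'
    -- This functional annihilates the bend, so only the position along the segment remains.
    linear_combination (bend b).2 * h1 - (bend b).1 * h2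
  subst hxy
  refine ⟨rfl, ?_⟩
  have h0 : x * (1 - x) ≠ 0 := (mul_pos hx.1 (sub_pos.2 hx.2)).ne'
  have h3 : x * (1 - x) * ((i : ℝ) - j) = 0 := by
    obtain hb | hb := bend_ne_zero b <;> simp only [Prod.mk.injEq] at hb
    · rw [hb.1] at h1; push_cast at h1; linear_combination 8 * h1
    · rw [hb.2] at h2; push_cast at h2; linear_combination 8 * h2
  exact_mod_cast sub_eq_zero.1 ((mul_eq_zero.1 h3).resolve_left h0)

lemma pos_injective : Function.Injective pos := by
  have : ∀ u v, pos u = pos v → u = v := by decide +kernel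
  exact fun u v ↦ this u v

lemma isPlanar : graph.IsPlanar := by
  refine ⟨fun v ↦ ((pos v).1, (pos v).2), arc, ?_, ?_, ?_, ?_⟩
  · intro u _ v _ h
    simp only [Prod.mk.injEq, Int.cast_inj] at h
    exact pos_injective (Prod.ext h.1 h.2)
  · refine fun e he ↦ ⟨?_, ?_, fst e.1, snd e.1, isLink he, ?_, ?_⟩
    · unfold arc
      fun_prop
    · intro x hx y _ h
      exact (arc_inj (b := e.1) (i := e.2) (j := e.2) hx h).1
    · simp [arc]
    · simp [arc]
  · intro e he x hx v _ h
    obtain ⟨l, -, hl⟩ := vertex_separated e.1 v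
    have := lt_linR_arc he hl hx
    rw [h] at this
    simp [linR, lin] at this
  · intro e he e' he' hne
    refine Set.disjoint_left.2 ?_
    rintro _ ⟨x, hx, rfl⟩ ⟨y, hy, h⟩
    by_cases hb : e.1 = e'.1
    · obtain ⟨b, i⟩ := e
      obtain ⟨b', j⟩ := e'
      obtain rfl : b = b' := hb
      exact hne (by rw [(arc_inj hy h).2])
    · obtain hs | hs := separated _ _ hb
      · exact hs.arc_ne he he' hx hy h.symm
      · exact hs.arc_ne he' he hy hx h

end Graph.BlownK4

/-! ### A discrete Jordan curve argument in the square lattice. -/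

namespace Lattice

/-- `u` and `v` are joined by a walk of the square lattice inside `S`. -/
def GridLinked (S : Set (ℤ × ℤ)) : ℤ × ℤ → ℤ × ℤ → Prop :=
  Relation.EqvGen fun p q ↦ p ∈ S ∧ q ∈ S ∧ (q = (p.1 + 1, p.2) ∨ q = (p.1, p.2 + 1))

/-- `T p` behaves like the number of times that some walk inside `S` from `u` to `v` crosses,
from left to right, the upward ray slightly to the left of `p`. -/
structure IsCrossingNumber (S : Set (ℤ × ℤ)) (u v : ℤ × ℤ) (T : ℤ → ℤ → ℤ) : Prop where
  up : ∀ x y, (x, y + 1) ∉ S → T x y = T x (y + 1)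
  right : ∀ x y, (x, y) ∉ S → T x y - T (x + 1) y =
    (if v.1 = x ∧ y < v.2 then 1 else 0) - (if u.1 = x ∧ y < u.2 then 1 else 0)
  bottom : (∀ p ∈ S, -1 ≤ p.2) → ∀ x, (x, -1) ∉ S → T x (-1) =
    (if x ≤ v.1 then 1 else 0) - (if x ≤ u.1 then 1 else 0)
  left : (∀ p ∈ S, -1 ≤ p.1) → ∀ y, T (-1) y = 0

/-- The four conditions are additive under concatenation and change sign under reversal, so only
single steps need a construction: a vertical step crosses no ray, and a step to the right crosses
the rays of the points below its right end. -/
lemma GridLinked.exists_isCrossingNumber {S : Set (ℤ × ℤ)} {u v : ℤ × ℤ} (h : GridLinked S u v) :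
    ∃ T, IsCrossingNumber S u v T := by
  induction h with
  | rel p q h =>
    obtain ⟨hp, hq, rfl | rfl⟩ := h
    · refine ⟨fun x y ↦ if x = p.1 + 1 ∧ y < p.2 then 1 else 0, ?_, ?_, ?_, ?_⟩
      · intro x y hxy
        have : ¬ (x = p.1 + 1 ∧ y + 1 = p.2) := fun h ↦ hxy (by rwa [h.1, h.2])
        split_ifs <;> omega
      · intro x y hxy
        dsimp only
        split_ifs <;> omega
      · intro hS x hx
        have := hS p hp
        have : ¬ (x = p.1 + 1 ∧ -1 = p.2) := fun h ↦ hx (by rwa [h.1, h.2])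
        dsimp only
        split_ifs <;> omega
      · intro hS y
        have := hS p hp
        rw [if_neg (by omega)]
    · refine ⟨fun x y ↦ 0, ?_, ?_, ?_, ?_⟩
      · simp
      · intro x y hxy
        have : ¬ (x = p.1 ∧ y = p.2) := fun h ↦ hxy (by rwa [h.1, h.2])
        dsimp only
        split_ifs <;> omega
      · simp
      · simp
  | refl p => exact ⟨fun _ _ ↦ 0, by simp, by simp, by simp, by simp⟩
  | symm p q _ ih =>
    obtain ⟨T, h1, h2, h3, h4⟩ := ih
    refine ⟨fun x y ↦ -T x y, fun x y hxy ↦ by rw [h1 x y hxy], fun x y hxy ↦ ?_,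
      fun hS x hx ↦ ?_, fun hS y ↦ by rw [h4 hS, neg_zero]⟩
    · linarith [h2 x y hxy]
    · linarith [h3 hS x hx]
  | trans p q r _ _ ih ih' =>
    obtain ⟨T, h1, h2, h3, h4⟩ := ih
    obtain ⟨T', h1', h2', h3', h4'⟩ := ih'
    refine ⟨fun x y ↦ T x y + T' x y, fun x y hxy ↦ by rw [h1 x y hxy, h1' x y hxy],
      fun x y hxy ↦ ?_, fun hS x hx ↦ ?_, fun hS y ↦ by rw [h4 hS, h4' hS, add_zero]⟩
    · linarith [h2 x y hxy, h2' x y hxy]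
    · linarith [h3 hS x hx, h3' hS x hx]

/-- If in the strip `-1 ≤ x ≤ W`, `-1 ≤ y` a walk from the left side to the right side is disjoint
from a walk from the left side to the bottom side, then it starts above it. -/
lemma lt_of_disjoint {S S' : Set (ℤ × ℤ)} {W a b c d : ℤ} (hd : Disjoint S S')
    (hS : ∀ p ∈ S, -1 ≤ p.1 ∧ -1 ≤ p.2) (hS' : ∀ p ∈ S', -1 ≤ p.1 ∧ p.1 ≤ W)
    (h : GridLinked S (-1, a) (W, b)) (h' : GridLinked S' (-1, c) (d, -1))
    (ha : (-1, a) ∈ S) (hd0 : 0 ≤ d)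
    (hdS : (d, -1) ∈ S') : c < a := by
  obtain ⟨T, h1, h2, h3, h4⟩ := h.exists_isCrossingNumber
  have hdis : ∀ p ∈ S', p ∉ S := fun p hp hp' ↦ Set.disjoint_left.1 hd hp' hp
  -- The crossing number is constant along a walk that avoids `S`, except for the jump in column
  -- `-1` caused by the starting point `(-1, a)`; the extra term cancels it. The end in column `W`
  -- causes no jump because `S'` does not extend to the right of that column.
  have key : ∀ p q, GridLinked S' p q →
      T p.1 p.2 + (if p.1 = -1 ∧ p.2 < a then 1 else 0) =
      T q.1 q.2 + (if q.1 = -1 ∧ q.2 < a then 1 else 0) := by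
    intro p q hpq
    induction hpq with
    | rel p q h =>
      obtain ⟨hp, hq, rfl | rfl⟩ := h
      · have := h2 p.1 p.2 (hdis p hp)
        have h5 := (hS' p hp).1
        have h6 := (hS' _ hq).2
        dsimp only at this h6 ⊢
        split_ifs at this ⊢ <;> omega
      · have := h1 p.1 p.2 (hdis _ hq)
        have h5 : ¬ (p.1 = -1 ∧ p.2 + 1 = a) := fun h ↦ hdis _ hq (by rw [h.1, h.2]; exact ha)
        dsimp only
        split_ifs <;> omega
    | refl p => rfl
    | symm p q _ ih => exact ih.symm
    | trans p q r _ _ ih ih' => exact ih.trans ih'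
  have h5 := key _ _ h'
  have h6 := h3 (fun p hp ↦ (hS p hp).2) d (hdis _ hdS)
  have h7 := h4 (fun p hp ↦ (hS p hp).1) c
  have h8 := (hS' _ hdS).2
  dsimp only at h5 h6 h7 h8
  -- At `(d, -1)` the crossing number is `1`, since `0 ≤ d ≤ W`; at `(-1, c)` it is `0`. Only the
  -- correction term can make up the difference, which forces `c < a`.
  rw [h6, h7] at h5
  split_ifs at h5 <;> omega

end Lattice

/-! ### The wall with gadgets, its clusters and their boundaries. -/

namespace Graph.Wall

open BlownK4 (mult sideFst sideSnd)

/-- The edges of the wall with gadgets: horizontal and vertical edges between lattice points, and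
the edges of the fat triangles. -/
inductive Edge : Type
  | hor (x y : ℤ)
  | ver (x y : ℤ)
  | side (t : Fin 3) (k : ℤ) (s : Fin 3) (i : ℕ)
  deriving DecidableEq

open Edge

/-- The vertex `r` of the `k`-th fat triangle of type `t`: triangles of type `0`, `1` and `2` lie on
the left, on the right and at the bottom of the wall. -/
def gad (m : ℤ) (t : Fin 3) (k : ℤ) (r : Fin 3) : ℤ × ℤ :=
  ![(-1, 3 * k + (r : ℕ)), (6 * m, 3 * k + 2 - (r : ℕ)), (6 * k + 5 - 2 * (r : ℕ), -1)] t

/-- The vertex set of the wall with gadgets. -/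
def verts (m : ℤ) : Set (ℤ × ℤ) :=
  {p | (-1 ≤ p.1 ∧ p.1 ≤ 6 * m ∧ 0 ≤ p.2 ∧ p.2 < 3 * m) ∨
    (p.2 = -1 ∧ 0 ≤ p.1 ∧ p.1 < 6 * m ∧ p.1 % 2 = 1)}

/-- The edge set of the wall with gadgets. -/
def edges (m : ℤ) : Set Edge :=
  {e | match e with
    | hor x y => -1 ≤ x ∧ x < 6 * m ∧ 0 ≤ y ∧ y < 3 * m
    | ver x y => 0 ≤ x ∧ x < 6 * m ∧ -1 ≤ y ∧ y + 1 < 3 * m ∧ (x + y) % 2 = 0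
    | side t k s i => 0 ≤ k ∧ k < m ∧ i < mult t s}

/-- The first end of an edge. -/
def src (m : ℤ) : Edge → ℤ × ℤ
  | hor x y => (x, y)
  | ver x y => (x, y)
  | side t k s _ => gad m t k (sideFst s)

/-- The second end of an edge. -/
def tgt (m : ℤ) : Edge → ℤ × ℤ
  | hor x y => (x + 1, y)
  | ver x y => (x, y + 1)
  | side t k s _ => gad m t k (sideSnd s)

lemma gad_mem {m : ℤ} {k : ℤ} (h0 : 0 ≤ k) (hm : k < m) (t r : Fin 3) : gad m t k r ∈ verts m := by
  fin_cases t <;> fin_cases r <;> simp [gad, verts] <;> omega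

lemma src_mem_tgt_mem {m : ℤ} {e : Edge} (he : e ∈ edges m) :
    src m e ∈ verts m ∧ tgt m e ∈ verts m := by
  match e, he with
  | hor x y, h => simp only [edges, Set.mem_ofPred_eq] at h; simp [src, tgt, verts]; omega
  | ver x y, h => simp only [edges, Set.mem_ofPred_eq] at h; simp [src, tgt, verts]; omega
  | side t k s i, h => exact ⟨gad_mem h.1 h.2.1 _ _, gad_mem h.1 h.2.1 _ _⟩

/-- The cubic wall with `m` gadgets of each type. -/
def graph (m : ℤ) : Graph (ℤ × ℤ) Edge :=
  ofEnds (verts m) (edges m) (src m) (tgt m) fun _ ↦ src_mem_tgt_mem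

lemma isLink {m : ℤ} {e : Edge} (he : e ∈ edges m) : (graph m).IsLink e (src m e) (tgt m e) :=
  ⟨he, .inl ⟨rfl, rfl⟩⟩

lemma gad_injective (m : ℤ) (t : Fin 3) (k : ℤ) : Function.Injective (gad m t k) := by
  intro r r' h
  rw [Fin.ext_iff]
  fin_cases t <;> simp [gad] at h <;> omega

lemma src_ne_tgt {m : ℤ} (e : Edge) : src m e ≠ tgt m e := by
  match e with
  | hor x y => simp [src, tgt]
  | ver x y => simp [src, tgt]
  | side t k s i =>
    exact fun h ↦ absurd (gad_injective m t k h) ((by decide : ∀ s, sideFst s ≠ sideSnd s) s)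

lemma isFiniteLoopless (m : ℤ) : (graph m).IsFiniteLoopless := by
  refine ⟨?_, ?_, ofEnds_loopless _ fun e _ ↦ src_ne_tgt e⟩
  · refine ((Set.finite_Icc (-1) (6 * m)).prod (Set.finite_Icc (-1) (3 * m))).subset fun p hp ↦ ?_
    simp only [graph, ofEnds, verts, Set.mem_ofPred_eq] at hp
    simp only [Set.mem_prod, Set.mem_Icc]
    omega
  · have hI := ((Set.finite_Icc (-1) (6 * m)).prod (Set.finite_Icc (-1) (3 * m)))
    refine ((hI.image fun p ↦ hor p.1 p.2).union ((hI.image fun p ↦ ver p.1 p.2).union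
      (((Set.finite_univ (α := Fin 3 × Fin 3)).prod ((Set.finite_Icc 0 m).prod
        (Set.finite_Iio 5))).image fun p ↦ side p.1.1 p.2.1 p.1.2 p.2.2))).subset fun e he ↦ ?_
    simp only [graph, ofEnds] at he
    match e, he with
    | hor x y, h =>
      simp only [edges, Set.mem_ofPred_eq] at h
      refine .inl ⟨(x, y), ?_, rfl⟩
      simp only [Set.mem_prod, Set.mem_Icc]
      omega
    | ver x y, h =>
      simp only [edges, Set.mem_ofPred_eq] at h
      refine .inr (.inl ⟨(x, y), ?_, rfl⟩)
      simp only [Set.mem_prod, Set.mem_Icc]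
      omega
    | side t k s i, h =>
      refine .inr (.inr ⟨((t, s), k, i), ?_, rfl⟩)
      have := (by decide : ∀ t s, mult t s ≤ 5) t s
      simp only [edges, Set.mem_ofPred_eq] at h
      simp only [Set.mem_prod, Set.mem_Icc, Set.mem_univ, Set.mem_Iio, true_and]
      omega

/-! ### Clusters -/

/-- The cluster of a vertex: the vertices of a gadget form a cluster, as does every single vertex of
the wall. -/
def cluster (m : ℤ) (p : ℤ × ℤ) : ℤ × ℤ :=
  if p.1 = -1 ∨ p.1 = 6 * m then (p.1, p.2 / 3) else if p.2 = -1 then (p.1 / 6, -1) else p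

/-- The edges leaving a cluster. -/
def leaving (m : ℤ) (c : ℤ × ℤ) : Set Edge :=
  {e | ∃ u v, (graph m).IsLink e u v ∧ cluster m u = c ∧ cluster m v ≠ c}

/-- A set of three edges that contains all edges leaving the cluster of `p`. -/
def boundary (m : ℤ) (p : ℤ × ℤ) : Finset Edge :=
  if p.1 = -1 then {hor (-1) (3 * (p.2 / 3)), hor (-1) (3 * (p.2 / 3) + 1),
    hor (-1) (3 * (p.2 / 3) + 2)}
  else if p.1 = 6 * m then {hor (6 * m - 1) (3 * (p.2 / 3)), hor (6 * m - 1) (3 * (p.2 / 3) + 1),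
    hor (6 * m - 1) (3 * (p.2 / 3) + 2)}
  else if p.2 = -1 then {ver (6 * (p.1 / 6) + 1) (-1), ver (6 * (p.1 / 6) + 3) (-1),
    ver (6 * (p.1 / 6) + 5) (-1)}
  else {hor (p.1 - 1) p.2, hor p.1 p.2, ver p.1 (if (p.1 + p.2) % 2 = 0 then p.2 else p.2 - 1)}

lemma card_boundary_le (m : ℤ) (p : ℤ × ℤ) : (boundary m p).card ≤ 3 := by
  unfold boundary
  split_ifs <;> exact Finset.card_le_three

lemma cluster_gad {m : ℤ} (t : Fin 3) {k : ℤ} (hk : 0 ≤ k) (r : Fin 3) :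
    cluster m (gad m t k r) = ![(-1, k), (6 * m, k), (k, -1)] t := by
  fin_cases t <;> simp only [gad, cluster] <;> fin_cases r <;> simp <;> grind

/-- A side of a fat triangle stays inside its cluster, so only lattice edges can leave. A gadget has
one for each of its three vertices; a wall vertex has its two horizontal edges and one vertical
edge, whose direction depends on parity. -/
lemma mem_boundary {m : ℤ} {p u v : ℤ × ℤ} {e : Edge} (hp : p ∈ verts m) (he : e ∈ edges m)
    (h : (u = src m e ∧ v = tgt m e) ∨ (u = tgt m e ∧ v = src m e))
    (hu : cluster m u = cluster m p) (hv : cluster m v ≠ cluster m p) : e ∈ boundary m p := by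
  obtain ⟨a, b⟩ := p
  simp only [verts, Set.mem_ofPred_eq] at hp
  match e, he with
  | hor x y, he =>
    simp only [edges, Set.mem_ofPred_eq] at he
    simp only [src, tgt] at h
    obtain ⟨rfl, rfl⟩ | ⟨rfl, rfl⟩ := h
    all_goals
      simp only [cluster, boundary] at hu hv ⊢
      split_ifs at hu ⊢ <;>
      simp only [Finset.mem_insert, Finset.mem_singleton, hor.injEq, reduceCtorEq, or_false,
        Prod.mk.injEq] at hu ⊢ <;>
      omega
  | ver x y, he =>
    simp only [edges, Set.mem_ofPred_eq] at he
    simp only [src, tgt] at h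
    obtain ⟨rfl, rfl⟩ | ⟨rfl, rfl⟩ := h
    all_goals
      simp only [cluster, boundary] at hu hv ⊢
      split_ifs at hu ⊢ <;>
      simp only [Finset.mem_insert, Finset.mem_singleton, ver.injEq, reduceCtorEq, false_or,
          or_false, Prod.mk.injEq] at hu ⊢ <;>
      omega
  | side t k s i, he =>
    exfalso
    simp only [src, tgt] at h
    obtain ⟨rfl, rfl⟩ | ⟨rfl, rfl⟩ := h <;>
    · rw [cluster_gad t he.1] at hu hv
      exact hv hu

lemma leaving_subset_boundary {m : ℤ} {p : ℤ × ℤ} (hp : p ∈ verts m) :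
    leaving m (cluster m p) ⊆ boundary m p := by
  rintro e ⟨u, v, ⟨he, h⟩, hu, hv⟩
  exact mem_boundary hp he h hu hv

lemma eq_gad_of_cluster_eq {m : ℤ} {p q : ℤ × ℤ} (hp : p ∈ verts m) (hq : q ∈ verts m)
    (hpq : p ≠ q) (h : cluster m p = cluster m q) :
    ∃ t k, 0 ≤ k ∧ k < m ∧ ∃ r, p = gad m t k r := by
  obtain ⟨a, b⟩ := p
  obtain ⟨c, d⟩ := q
  simp only [verts, Set.mem_ofPred_eq] at hp hq
  by_cases h1 : a = -1
  · refine ⟨0, b / 3, by omega, by omega, ⟨(b % 3).toNat, by omega⟩, ?_⟩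
    simp [gad]
    omega
  by_cases h2 : a = 6 * m
  · refine ⟨1, b / 3, by omega, by omega, ⟨(2 - b % 3).toNat, by omega⟩, ?_⟩
    simp [gad]
    omega
  by_cases h3 : b = -1
  · refine ⟨2, a / 6, by omega, by omega, ⟨((5 - a % 6) / 2).toNat, by omega⟩, ?_⟩
    simp [gad]
    omega
  simp only [cluster, h1, h2, h3, or_false, if_false] at h
  split_ifs at h <;> simp only [Prod.mk.injEq, ne_eq] at h hpq <;> omega

lemma eq_of_cluster_gad_eq {m : ℤ} {t t' : Fin 3} {k k' : ℤ} {r r' : Fin 3} (hk : 0 ≤ k)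
    (hm : k < m) (hk' : 0 ≤ k') (hm' : k' < m)
    (h : cluster m (gad m t k r) = cluster m (gad m t' k' r')) : t = t' ∧ k = k' := by
  rw [cluster_gad t hk, cluster_gad t' hk'] at h
  fin_cases t <;> fin_cases t' <;> simp at h <;> omega

/-- The number of edges incident with a vertex of a gadget. -/
def gadDegree (t r : Fin 3) : ℕ :=
  1 + ∑ s with sideFst s = r ∨ sideSnd s = r, mult t s

/-- A set containing all edges at a vertex of a gadget. -/
def star (m : ℤ) (t : Fin 3) (k : ℤ) (r : Fin 3) : Finset Edge :=
  insert (![hor (-1) (3 * k + (r : ℕ)), hor (6 * m - 1) (3 * k + 2 - (r : ℕ)),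
      ver (6 * k + 5 - 2 * (r : ℕ)) (-1)] t)
    ((Finset.univ.filter fun s ↦ sideFst s = r ∨ sideSnd s = r).biUnion
      fun s ↦ (Finset.range (mult t s)).image (side t k s))

lemma card_star_le (m : ℤ) (t : Fin 3) (k : ℤ) (r : Fin 3) :
    (star m t k r).card ≤ gadDegree t r := by
  refine (Finset.card_insert_le _ _).trans ?_
  rw [gadDegree, add_comm]
  gcongr
  refine Finset.card_biUnion_le.trans (Finset.sum_le_sum fun s _ ↦ ?_)
  exact Finset.card_image_le.trans_eq (Finset.card_range _)

lemma mem_star {m : ℤ} {t : Fin 3} {k : ℤ} {r : Fin 3} (hk : 0 ≤ k) (hm : k < m) {e : Edge}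
    {v : ℤ × ℤ} (h : (graph m).IsLink e (gad m t k r) v) : e ∈ star m t k r := by
  obtain ⟨he, h⟩ := h
  replace h : gad m t k r = src m e ∨ gad m t k r = tgt m e := h.imp And.left And.left
  rw [star, Finset.mem_insert]
  match e, he with
  | hor x y, he =>
    left
    simp only [edges, Set.mem_ofPred_eq] at he
    fin_cases t <;> simp [gad, src, tgt] at h ⊢ <;> omega
  | ver x y, he =>
    left
    simp only [edges, Set.mem_ofPred_eq] at he
    fin_cases t <;> simp [gad, src, tgt] at h ⊢ <;> omega
  | side t' k' s i, he =>
    right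
    have key : t = t' ∧ k = k' := by
      obtain h | h := h <;>
        exact eq_of_cluster_gad_eq hk hm he.1 he.2.1 (congrArg (cluster m) h)
    obtain ⟨rfl, rfl⟩ := key
    simp only [Finset.mem_biUnion, Finset.mem_filter, Finset.mem_univ, true_and]
    refine ⟨s, h.imp (fun h ↦ (gad_injective m t k h).symm) fun h ↦ (gad_injective m t k h).symm,
      Finset.mem_image_of_mem _ (Finset.mem_range.2 he.2.2)⟩

end Graph.Wall

/-! ### Rigidity of immersions in the wall, and the absence of packings. -/

namespace Graph.Wall

open BlownK4 (mult sideFst sideSnd sideBundle Vert Bundle bundleMult fst snd)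
open Edge

/-- The edges of the blown-up `K₄` at a vertex. -/
def edgesAt (v : Vert) : Finset (Bundle × ℕ) :=
  (Finset.univ ×ˢ Finset.range 5).filter fun e ↦
    e.2 < bundleMult e.1 ∧ (fst e.1 = v ∨ snd e.1 = v)

/-- A triangle vertex of `H` and its counterpart in a gadget have the same degree: the gadget's edge
into the wall takes the place of the spoke or of the edge to another triangle. -/
lemma card_edgesAt : ∀ t r, (edgesAt (some (t, r))).card = gadDegree t r := by
  decide +kernel

lemma exists_isLink_of_mem_edgesAt {v : Vert} {e : Bundle × ℕ} (he : e ∈ edgesAt v) :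
    ∃ u, BlownK4.graph.IsLink e v u ∧ u ≠ v := by
  simp only [edgesAt, Finset.mem_filter] at he
  obtain ⟨-, he, rfl | rfl⟩ := he
  · exact ⟨_, BlownK4.isLink he, (BlownK4.fst_ne_snd _).symm⟩
  · exact ⟨_, (BlownK4.isLink he).symm, BlownK4.fst_ne_snd _⟩

/-- The degree sequences are `(8, 9, 8)`, `(7, 10, 8)` and `(7, 11, 7)`. Each sums to `25`, so
domination up to a permutation is equality up to a permutation, and as multisets the three differ.
The multiplicities are chosen for this. -/
lemma eq_of_gadDegree_le : ∀ t t' : Fin 3, ∀ a b c : Fin 3, a ≠ b → a ≠ c → b ≠ c →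
    gadDegree t 0 ≤ gadDegree t' a → gadDegree t 1 ≤ gadDegree t' b →
    gadDegree t 2 ≤ gadDegree t' c → t = t' := by
  decide +kernel

section

variable {m : ℤ} {M : Graph (ℤ × ℤ) Edge} {φ : Vert → ℤ × ℤ} {S : Bundle × ℕ → Set Edge}

/-- Otherwise four edge-disjoint paths would leave a cluster that has at most three outgoing edges.
-/
lemma cluster_eq_of_four_le (h : HasImmersionIn BlownK4.graph (graph m) M φ S)
    (hV : ∀ v, φ v ∈ verts m) {b : Bundle} (hb : 4 ≤ bundleMult b) :
    cluster m (φ (fst b)) = cluster m (φ (snd b)) := by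
  by_contra hne
  have h1 := h.card_le_boundary (K := {p | cluster m p = cluster m (φ (fst b))})
    (F := {b} ×ˢ Finset.range (bundleMult b)) (B := boundary m (φ (fst b))) ?_ ?_
  · have h2 := card_boundary_le m (φ (fst b))
    rw [Finset.card_product, Finset.card_singleton, Finset.card_range] at h1
    omega
  · rintro ⟨b', i⟩ he
    simp only [Finset.mem_product, Finset.mem_singleton, Finset.mem_range] at he
    obtain ⟨rfl, hi⟩ := he
    exact ⟨_, _, BlownK4.isLink (e := (b', i)) hi, rfl, fun h ↦ hne h.symm⟩
  · intro e u v he hu hv _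
    exact leaving_subset_boundary (hV _) ⟨u, v, he, hu, hv⟩

/-- In every immersion, the fat triangle of type `t` is mapped to a gadget of type `t`. -/
lemma exists_gad (h : HasImmersionIn BlownK4.graph (graph m) M φ S)
    (hV : ∀ v, φ v ∈ verts m) (t : Fin 3) :
    ∃ k, 0 ≤ k ∧ k < m ∧ ∀ r, ∃ r', φ (some (t, r)) = gad m t k r' := by
  have hinj : ∀ {u v}, u ≠ v → φ u ≠ φ v := fun huv he ↦
    huv (h.1 (Set.mem_univ _) (Set.mem_univ _) he)
  have h01 : cluster m (φ (some (t, 0))) = cluster m (φ (some (t, 1))) :=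
    cluster_eq_of_four_le h hV (b := (t, 0)) ((by decide : ∀ t, 4 ≤ bundleMult (t, 0)) t)
  have h12 : cluster m (φ (some (t, 1))) = cluster m (φ (some (t, 2))) :=
    cluster_eq_of_four_le h hV (b := (t, 1)) ((by decide : ∀ t, 4 ≤ bundleMult (t, 1)) t)
  have n01 : φ (some (t, 0)) ≠ φ (some (t, 1)) := hinj (by simp)
  have n02 : φ (some (t, 0)) ≠ φ (some (t, 2)) := hinj (by simp)
  have n12 : φ (some (t, 1)) ≠ φ (some (t, 2)) := hinj (by simp)
  obtain ⟨t', k, hk, hm, a, ha⟩ := eq_gad_of_cluster_eq (hV _) (hV _) n01 h01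
  obtain ⟨t₁, k₁, hk₁, hm₁, b, hb⟩ := eq_gad_of_cluster_eq (hV _) (hV _) n01.symm h01.symm
  obtain ⟨t₂, k₂, hk₂, hm₂, c, hc⟩ := eq_gad_of_cluster_eq (hV _) (hV _) n12.symm h12.symm
  obtain ⟨rfl, rfl⟩ := eq_of_cluster_gad_eq hk hm hk₁ hm₁ (ha ▸ hb ▸ h01)
  obtain ⟨rfl, rfl⟩ := eq_of_cluster_gad_eq hk hm hk₂ hm₂ (hb ▸ hc ▸ h12)
  -- Apply the cut bound to a single vertex: an immersion cannot map a vertex to one of smaller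
  -- degree.
  have hdeg : ∀ r r', φ (some (t, r)) = gad m t' k r' → gadDegree t r ≤ gadDegree t' r' := by
    intro r r' hr
    rw [← card_edgesAt]
    refine (h.card_le_boundary (K := {gad m t' k r'}) (B := star m t' k r') ?_ ?_).trans
      (card_star_le m t' k r')
    · intro e he
      obtain ⟨u, hu, hne⟩ := exists_isLink_of_mem_edgesAt he
      exact ⟨_, u, hu, hr, fun h ↦ hinj hne (h.trans hr.symm)⟩
    · rintro e u v he rfl _ _
      exact mem_star hk hm he
  obtain rfl := eq_of_gadDegree_le t t' a b c (fun h ↦ n01 (by rw [ha, hb, h]))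
    (fun h ↦ n02 (by rw [ha, hc, h])) (fun h ↦ n12 (by rw [hb, hc, h]))
    (hdeg _ _ ha) (hdeg _ _ hb) (hdeg _ _ hc)
  refine ⟨k, hk, hm, fun r ↦ ?_⟩
  fin_cases r
  exacts [⟨a, ha⟩, ⟨b, hb⟩, ⟨c, hc⟩]

/-- At least two edges of `M` leave the cluster `c`. -/
def IsHeavy (m : ℤ) (M : Graph (ℤ × ℤ) Edge) (c : ℤ × ℤ) : Prop :=
  ∃ e ∈ E(M), ∃ f ∈ E(M), e ≠ f ∧ e ∈ leaving m c ∧ f ∈ leaving m c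

lemma IsHeavy.not_of_disjoint {M' : Graph (ℤ × ℤ) Edge} (hM : Disjoint E(M) E(M'))
    {p : ℤ × ℤ} (hp : p ∈ verts m) (h : IsHeavy m M (cluster m p)) :
    ¬ IsHeavy m M' (cluster m p) := by
  rintro ⟨e', he', f', hf', hne', hel', hfl'⟩
  obtain ⟨e, he, f, hf, hne, hel, hfl⟩ := h
  have hd : ∀ {x y}, x ∈ E(M) → y ∈ E(M') → x ≠ y := fun hx hy hxy ↦
    Set.disjoint_left.1 hM hx (hxy ▸ hy)
  have h4 : ({e, f, e', f'} : Finset Edge).card = 4 := by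
    rw [Finset.card_eq_succ]
    refine ⟨e, {f, e', f'}, ?_, rfl, Finset.card_eq_three.2 ⟨f, e', f', hd hf he', hd hf hf',
      hne', rfl⟩⟩
    simp [hne, hd he he', hd he hf']
  have h3 : ({e, f, e', f'} : Finset Edge) ⊆ boundary m p := by
    have := leaving_subset_boundary hp
    intro x hx
    simp only [Finset.mem_insert, Finset.mem_singleton] at hx
    obtain rfl | rfl | rfl | rfl := hx
    exacts [this hel, this hfl, this hel', this hfl']
  have := (Finset.card_le_card h3).trans (card_boundary_le m p)
  omega

/-- The images of the edges to the two other fat triangles both leave this gadget, since those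
triangles sit in gadgets of other types, and they are edge-disjoint. -/
lemma isHeavy_gad (h : HasImmersionIn BlownK4.graph (graph m) M φ S)
    (hV : ∀ v, φ v ∈ verts m) (t r : Fin 3) : IsHeavy m M (cluster m (φ (some (t, r)))) := by
  obtain ⟨k, hk, hm, hr⟩ := exists_gad h hV t
  obtain ⟨k', hk', hm', hr'⟩ := exists_gad h hV (t + 1)
  obtain ⟨k'', hk'', hm'', hr''⟩ := exists_gad h hV (t - 1)
  have hc : ∀ r', cluster m (φ (some (t, r'))) = cluster m (φ (some (t, r))) := by
    intro r'
    obtain ⟨a, ha⟩ := hr r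
    obtain ⟨b, hb⟩ := hr r'
    rw [ha, hb, cluster_gad t hk, cluster_gad t hk]
  have hc' : cluster m (φ (some (t + 1, 0))) ≠ cluster m (φ (some (t, r))) := by
    obtain ⟨a, ha⟩ := hr r
    obtain ⟨b, hb⟩ := hr' 0
    rw [ha, hb]
    exact fun h ↦ absurd (eq_of_cluster_gad_eq hk' hm' hk hm h).1 (by simp)
  have hc'' : cluster m (φ (some (t - 1, 2))) ≠ cluster m (φ (some (t, r))) := by
    obtain ⟨a, ha⟩ := hr r
    obtain ⟨b, hb⟩ := hr'' 2
    rw [ha, hb]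
    exact fun h ↦ absurd (eq_of_cluster_gad_eq hk'' hm'' hk hm h).1 (by simp)
  have l1 : BlownK4.graph.IsLink ((t, 4), 0) (some (t, 2)) (some (t + 1, 0)) :=
    BlownK4.isLink (BlownK4.bundleMult_pos _)
  have l2 : BlownK4.graph.IsLink ((t - 1, 4), 0) (some (t - 1, 2)) (some (t, 0)) := by
    have := BlownK4.isLink (e := ((t - 1, 4), 0)) (BlownK4.bundleMult_pos _)
    simpa [fst, snd] using this
  obtain ⟨e, he, u, v, huv, hu, hv⟩ := (h.2.2.2 _ _ _ l1).exists_boundary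
    (K := {p | cluster m p = cluster m (φ (some (t, r)))}) (fun h ↦ hc' (h.1 (hc 2)))
  obtain ⟨f, hf, u', v', huv', hu', hv'⟩ := (h.2.2.2 _ _ _ l2).exists_boundary
    (K := {p | cluster m p = cluster m (φ (some (t, r)))}) (fun h ↦ hc'' (h.2 (hc 0)))
  refine ⟨e, h.2.1 _ l1.edge_mem he, f, h.2.1 _ l2.edge_mem hf, ?_, ⟨u, v, huv, hu, hv⟩,
    ⟨u', v', huv', hu', hv'⟩⟩
  rintro rfl
  exact Set.disjoint_left.1 (h.2.2.1 _ l1.edge_mem _ l2.edge_mem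
    (by simpa using (by decide : ∀ t : Fin 3, t ≠ t - 1) t)) he hf

/-- The lattice points that belong to heavy clusters. -/
def heavySet (m : ℤ) (M : Graph (ℤ × ℤ) Edge) : Set (ℤ × ℤ) :=
  {p | IsHeavy m M (cluster m p) ∧ ∃ q ∈ verts m, cluster m p = cluster m q}

lemma mem_strip_of_mem_heavySet (p : ℤ × ℤ) (hp : p ∈ heavySet m M) :
    -1 ≤ p.1 ∧ p.1 ≤ 6 * m ∧ -1 ≤ p.2 := by
  obtain ⟨-, q, hq, h⟩ := hp
  obtain ⟨x, y⟩ := p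
  obtain ⟨a, b⟩ := q
  simp only [verts, Set.mem_ofPred_eq, cluster] at hq h ⊢
  split_ifs at h <;> simp only [Prod.mk.injEq] at h <;> omega

lemma disjoint_heavySet {M' : Graph (ℤ × ℤ) Edge} (hM : Disjoint E(M) E(M')) :
    Disjoint (heavySet m M) (heavySet m M') := by
  refine Set.disjoint_left.2 fun p ⟨h, q, hq, hpq⟩ ⟨h', _⟩ ↦ ?_
  rw [hpq] at h h'
  exact h.not_of_disjoint hM hq h'

/-- Vertices of a bottom gadget lie two lattice steps apart. The points between them are not
vertices of the wall, but they have the same cluster label, so the lattice walk may pass through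
them. -/
lemma gridLinked_gad {s : Set (ℤ × ℤ)} {t : Fin 3} {k : ℤ} (hk : 0 ≤ k)
    (hs : ∀ p, cluster m p = ![(-1, k), (6 * m, k), (k, -1)] t → p ∈ s) (r r' : Fin 3) :
    Lattice.GridLinked s (gad m t k r) (gad m t k r') := by
  have hr : ∀ x y, cluster m (x, y) = ![(-1, k), (6 * m, k), (k, -1)] t →
      cluster m (x + 1, y) = ![(-1, k), (6 * m, k), (k, -1)] t →
      Lattice.GridLinked s (x, y) (x + 1, y) := fun x y h h' ↦
    .rel _ _ ⟨hs _ h, hs _ h', .inl rfl⟩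
  have hu : ∀ x y, cluster m (x, y) = ![(-1, k), (6 * m, k), (k, -1)] t →
      cluster m (x, y + 1) = ![(-1, k), (6 * m, k), (k, -1)] t →
      Lattice.GridLinked s (x, y) (x, y + 1) := fun x y h h' ↦
    .rel _ _ ⟨hs _ h, hs _ h', .inr rfl⟩
  have key : Lattice.GridLinked s (gad m t k 0) (gad m t k 1) ∧
      Lattice.GridLinked s (gad m t k 1) (gad m t k 2) := by
    obtain rfl | rfl | rfl := (by decide : ∀ t : Fin 3, t = 0 ∨ t = 1 ∨ t = 2) t
    · have h0 : gad m 0 k 0 = (-1, 3 * k) := by simp [gad]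
      have h1 : gad m 0 k 1 = (-1, 3 * k + 1) := by simp [gad]
      have h2 : gad m 0 k 2 = (-1, 3 * k + 1 + 1) := by simp [gad]; ring
      rw [h0, h1, h2]
      constructor <;> apply hu <;> simp [cluster] <;> omega
    · have h0 : gad m 1 k 0 = (6 * m, 3 * k + 1 + 1) := by simp [gad]; ring
      have h1 : gad m 1 k 1 = (6 * m, 3 * k + 1) := by simp [gad]; ring
      have h2 : gad m 1 k 2 = (6 * m, 3 * k) := by simp [gad]
      rw [h0, h1, h2]
      constructor <;> refine .symm _ _ ?_ <;> apply hu <;> simp [cluster] <;> omega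
    · have h0 : gad m 2 k 0 = (6 * k + 5, -1) := by simp [gad]
      have h1 : gad m 2 k 1 = (6 * k + 3, -1) := by simp [gad]; ring
      have h2 : gad m 2 k 2 = (6 * k + 1, -1) := by simp [gad]; ring
      have hc : ∀ j, 1 ≤ j → j ≤ 5 → cluster m (6 * k + j, -1) = (k, -1) := by
        intro j h1 h5
        simp only [cluster]
        rw [if_neg (by omega), if_pos trivial]
        simp only [Prod.mk.injEq, and_true]
        omega
      have hl : ∀ j, 1 ≤ j → j ≤ 4 →
          Lattice.GridLinked s (6 * k + j, -1) (6 * k + (j + 1), -1) := by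
        intro j h1 h4
        rw [← add_assoc]
        exact hr _ _ (hc j h1 (by omega)) (by rw [add_assoc]; exact hc _ (by omega) (by omega))
      rw [h0, h1, h2]
      exact ⟨.symm _ _ (.trans _ _ _ (hl 3 (by omega) (by omega)) (hl 4 (by omega) (by omega))),
        .symm _ _ (.trans _ _ _ (hl 1 (by omega) (by omega)) (hl 2 (by omega) (by omega)))⟩
  have key' : ∀ r, Lattice.GridLinked s (gad m t k 1) (gad m t k r) := by
    intro r
    fin_cases r
    exacts [.symm _ _ key.1, .refl _, key.2]
  exact .trans _ _ _ (.symm _ _ (key' r)) (key' r')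

/-- A side of a gadget need not be a lattice step; it is replaced by a lattice walk within its
cluster. -/
lemma gridLinked_of_isLink {s : Set (ℤ × ℤ)} {e : Edge} {u v : ℤ × ℤ}
    (h : (graph m).IsLink e u v) (hu : ∀ p, cluster m p = cluster m u → p ∈ s)
    (hv : v ∈ s) : Lattice.GridLinked s u v := by
  have hu' := hu u rfl
  obtain ⟨he, h⟩ := h
  match e, he with
  | hor x y, he =>
    obtain ⟨rfl, rfl⟩ | ⟨rfl, rfl⟩ := h
    · exact .rel _ _ ⟨hu', hv, .inl rfl⟩
    · exact .symm _ _ (.rel _ _ ⟨hv, hu', .inl rfl⟩)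
  | ver x y, he =>
    obtain ⟨rfl, rfl⟩ | ⟨rfl, rfl⟩ := h
    · exact .rel _ _ ⟨hu', hv, .inr rfl⟩
    · exact .symm _ _ (.rel _ _ ⟨hv, hu', .inr rfl⟩)
  | side t k r i, he =>
    obtain ⟨rfl, rfl⟩ | ⟨rfl, rfl⟩ := h <;>
    · simp only [src, tgt, cluster_gad t he.1] at hu ⊢
      exact gridLinked_gad he.1 hu _ _

lemma gridLinked_of_isWalk {s : Set (ℤ × ℤ)} {u v : ℤ × ℤ} {w : List (Edge × (ℤ × ℤ))}
    (h : (graph m).IsWalk u w v)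
    (hs : ∀ z ∈ u :: w.map Prod.snd, ∀ p, cluster m p = cluster m z → p ∈ s) :
    Lattice.GridLinked s u v := by
  induction h with
  | nil _ => exact .refl _
  | @cons x y z e w h hw ih =>
    refine .trans _ _ _ (gridLinked_of_isLink h (hs x (by simp)) (hs y (by simp) y rfl))
      (ih fun z hz ↦ hs z ?_)
    simp only [List.map_cons, List.mem_cons] at hz ⊢
    tauto

/-- The path joining two fat triangles stays in heavy clusters. -/
lemma gridLinked_of_immersion (h : HasImmersionIn BlownK4.graph (graph m) M φ S)
    (hV : ∀ v, φ v ∈ verts m) (t : Fin 3) :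
    Lattice.GridLinked (heavySet m M) (φ (some (t, 2))) (φ (some (t + 1, 0))) := by
  have l1 : BlownK4.graph.IsLink ((t, 4), 0) (some (t, 2)) (some (t + 1, 0)) :=
    BlownK4.isLink (BlownK4.bundleMult_pos _)
  obtain ⟨w, hw, hS⟩ := (h.2.2.2 _ _ _ l1).exists_isPath
  refine gridLinked_of_isWalk hw.1 fun z hz p hpz ↦ ?_
  have hzV : z ∈ verts m := by
    obtain ⟨w₁, w₂, -, -, h₂, -⟩ := hw.1.exists_append hz
    exact h₂.left_mem
  refine ⟨?_, z, hzV, hpz⟩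
  rw [hpz]
  by_cases h1 : cluster m (φ (some (t, 2))) = cluster m z
  · exact h1 ▸ isHeavy_gad h hV _ _
  by_cases h2 : cluster m (φ (some (t + 1, 0))) = cluster m z
  · exact h2 ▸ isHeavy_gad h hV _ _
  -- A cluster containing neither end of the path is both entered and left by it, through two
  -- different edges.
  obtain ⟨e, he, f, hf, hne, he', hf'⟩ := hw.exists_two_boundary
    (K := {p | cluster m p = cluster m z}) h1 h2 hz rfl
  exact ⟨e, h.2.1 _ l1.edge_mem (hS e he), f, h.2.1 _ l1.edge_mem (hS f hf), hne, he', hf'⟩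

end

lemma exists_gridLinked {m : ℤ} {M : Graph (ℤ × ℤ) Edge} (hM : M ≤ graph m)
    (h : ErdosPosa.IsoToMember (ErdosPosa.immersionClass BlownK4.graph) M) :
    ∃ k, ∃ r r' : Fin 3, ∃ b d : ℤ, 0 ≤ k ∧ k < m ∧ 0 ≤ d ∧ IsHeavy m M (-1, k) ∧
      Lattice.GridLinked (heavySet m M) (gad m 0 k r) (6 * m, b) ∧
      Lattice.GridLinked (heavySet m M) (gad m 0 k r') (d, -1) ∧ (d, -1) ∈ heavySet m M := by
  obtain ⟨φ, S, h, hV⟩ := exists_hasImmersionIn hM h ⟨none, Set.mem_univ _⟩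
  replace hV : ∀ v, φ v ∈ verts m := fun v ↦ hM.vertexSet_mono (hV v (Set.mem_univ _))
  obtain ⟨k, hk, hm, hA⟩ := exists_gad h hV 0
  obtain ⟨k₁, hk₁, hm₁, hB⟩ := exists_gad h hV 1
  obtain ⟨k₂, hk₂, hm₂, hC⟩ := exists_gad h hV 2
  obtain ⟨r, hr⟩ := hA 2
  obtain ⟨r', hr'⟩ := hA 0
  obtain ⟨a, ha⟩ := hB 0
  obtain ⟨c, hc⟩ := hC 2
  have hAB := gridLinked_of_immersion h hV 0
  have hCA := gridLinked_of_immersion h hV 2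
  have hH := isHeavy_gad h hV 0 2
  have hH' := isHeavy_gad h hV 2 2
  simp only [show (0 : Fin 3) + 1 = 1 from rfl, show (2 : Fin 3) + 1 = 0 from rfl] at hAB hCA
  rw [hr, ha] at hAB
  rw [hc, hr'] at hCA
  rw [hr, cluster_gad 0 hk] at hH
  rw [hc] at hH'
  refine ⟨k, r, r', _, _, hk, hm, ?_, hH, hAB, .symm _ _ hCA, hH', _, gad_mem hk₂ hm₂ 2 c, rfl⟩
  omega

/-- Two edge-disjoint subgraphs cannot both contain the blown-up `K₄` as an immersion. -/
lemma not_disjoint_edgeSet {m : ℤ} {M M' : Graph (ℤ × ℤ) Edge} (hM : M ≤ graph m)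
    (hM' : M' ≤ graph m)
    (h : ErdosPosa.IsoToMember (ErdosPosa.immersionClass BlownK4.graph) M)
    (h' : ErdosPosa.IsoToMember (ErdosPosa.immersionClass BlownK4.graph) M') :
    ¬ Disjoint E(M) E(M') := by
  intro hd
  -- The left-right path of `M₁` starts strictly above the left-bottom path of `M₂`. Only the gadget
  -- indices are comparable, because the starting vertices within a gadget are unknown; hence the
  -- weak inequality.
  have key : ∀ {M₁ M₂ : Graph (ℤ × ℤ) Edge}, Disjoint E(M₁) E(M₂) → ∀ {k k' b d : ℤ}
      {r r' : Fin 3}, 0 ≤ k → k < m → IsHeavy m M₁ (-1, k) →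
      Lattice.GridLinked (heavySet m M₁) (gad m 0 k r) (6 * m, b) → 0 ≤ d →
      Lattice.GridLinked (heavySet m M₂) (gad m 0 k' r') (d, -1) → (d, -1) ∈ heavySet m M₂ →
      k' ≤ k := by
    intro M₁ M₂ hd k k' b d r r' hk hm hH h1 hd0 h2 h3
    have := Lattice.lt_of_disjoint (disjoint_heavySet hd)
      (fun p hp ↦ ⟨(mem_strip_of_mem_heavySet p hp).1, (mem_strip_of_mem_heavySet p hp).2.2⟩)
      (fun p hp ↦ ⟨(mem_strip_of_mem_heavySet p hp).1, (mem_strip_of_mem_heavySet p hp).2.1⟩)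
      h1 h2 ⟨(cluster_gad 0 hk r).symm ▸ hH, _, gad_mem hk hm 0 r, rfl⟩ hd0 h3
    omega
  obtain ⟨k, r, s, b, d, hk, hm, hd0, hH, h1, h2, h3⟩ := exists_gridLinked hM h
  obtain ⟨k', r', s', b', d', hk', hm', hd0', hH', h1', h2', h3'⟩ := exists_gridLinked hM' h'
  obtain rfl : k = k' := le_antisymm (key hd.symm hk' hm' hH' h1' hd0 h2 h3)
    (key hd hk hm hH h1 hd0' h2' h3')
  have hc : cluster m (gad m 0 k 0) = (-1, k) := cluster_gad 0 hk 0
  rw [← hc] at hH hH'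
  exact hH.not_of_disjoint hd (gad_mem hk hm 0 0) hH'

lemma not_hasEdgePacking (m : ℤ) :
    ¬ ErdosPosa.HasEdgePacking (ErdosPosa.immersionClass BlownK4.graph) (graph m) 2 := by
  classical
  rintro ⟨P, hP, hM, hd⟩
  obtain ⟨M, M', hne, rfl⟩ := Finset.card_eq_two.1 hP
  exact not_disjoint_edgeSet (hM M (by simp)).1 (hM M' (by simp)).1 (hM M (by simp)).2
    (hM M' (by simp)).2 (hd M (by simp) M' (by simp) hne)

lemma not_hasVertexPacking (m : ℤ) :
    ¬ ErdosPosa.HasVertexPacking (ErdosPosa.immersionClass BlownK4.graph) (graph m) 2 := by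
  rintro ⟨P, hP, hM, hd⟩
  refine not_hasEdgePacking m ⟨P, hP, hM, fun M hMP N hNP hne ↦ ?_⟩
  refine Set.disjoint_left.2 fun e he he' ↦ ?_
  obtain ⟨x, y, h⟩ := exists_isLink_of_mem_edgeSet he
  obtain ⟨x', y', h'⟩ := exists_isLink_of_mem_edgeSet he'
  have hx := (hd M hMP N hNP hne)
  obtain rfl | rfl := (h.mono (hM M hMP).1).left_eq_or_eq (h'.mono (hM N hNP).1)
  · exact Set.disjoint_left.1 hx h.left_mem h'.left_mem
  · exact Set.disjoint_left.1 hx h.left_mem h'.right_mem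

end Graph.Wall

/-! ### Immersions inside strips, and the absence of small covers. -/

namespace Graph.Wall

open BlownK4 (mult sideFst sideSnd sideBundle Vert Bundle bundleMult fst snd)
open Edge

/-- The vertices of the wall in the `i`-th strip of rows or in the `j`-th strip of columns. -/
def stripVerts (m i j : ℤ) : Set (ℤ × ℤ) := {p ∈ verts m | p.2 / 3 = i ∨ p.1 / 6 = j}

/-- The subgraph of the wall induced by a strip of rows and a strip of columns. -/
def strip (m i j : ℤ) : Graph (ℤ × ℤ) Edge := (graph m).induce (stripVerts m i j)

lemma strip_le (m i j : ℤ) : strip m i j ≤ graph m := induce_le fun _ hp ↦ hp.1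

section

variable {m i j : ℤ}

lemma strip_isFiniteLoopless : (strip m i j).IsFiniteLoopless := by
  obtain ⟨h1, h2, h3⟩ := isFiniteLoopless m
  refine ⟨h1.subset (strip_le m i j).vertexSet_mono, h2.subset (strip_le m i j).edgeSet_mono,
    ⟨fun e x hx ↦ h3.not_isLoopAt e x (IsLink.mono (strip_le m i j) hx)⟩⟩

lemma strip_isLink {e : Edge} (he : e ∈ edges m) (hs : src m e ∈ stripVerts m i j)
    (ht : tgt m e ∈ stripVerts m i j) : (strip m i j).IsLink e (src m e) (tgt m e) :=
  ⟨isLink he, hs, ht⟩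

variable {S : Set Edge}

lemma linked_row {y : ℤ} (hy0 : 0 ≤ y) (hym : y < 3 * m) (hyi : y / 3 = i) {a b : ℤ}
    (ha : -1 ≤ a) (hab : a ≤ b) (hb : b ≤ 6 * m) (hS : ∀ x, a ≤ x → x < b → hor x y ∈ S) :
    (strip m i j).Linked S (a, y) (b, y) := by
  have hmem : ∀ x, -1 ≤ x → x ≤ 6 * m → (x, y) ∈ stripVerts m i j := fun x h1 h2 ↦
    ⟨.inl ⟨h1, h2, hy0, hym⟩, .inl hyi⟩
  induction b, hab using Int.leInduction with
  | base => exact .refl (hmem a ha hb)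
  | succ b hab ih =>
    refine (ih (by omega) fun x h1 h2 ↦ hS x h1 (by omega)).trans
      (.of_isLink (e := hor b y) (strip_isLink ?_ ?_ ?_) (hS b hab (by omega)))
    · exact ⟨by omega, by omega, hy0, hym⟩
    · exact hmem b (by omega) (by omega)
    · exact hmem (b + 1) (by omega) (by omega)

/-- Climb within the columns `2 * c` and `2 * c + 1`, using one horizontal edge between consecutive
vertical ones. The vertices with `x + y` odd are those entered by a vertical edge from below, so the
climb can stop at row `y` without using a horizontal edge of that row. -/
lemma linked_column {c : ℤ} (hc0 : 0 ≤ c) (hcm : c < 3 * m) (hcj : c / 3 = j) {y : ℤ}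
    (hy0 : 0 ≤ y) (hym : y < 3 * m)
    (hv : ∀ x y', 2 * c ≤ x → x ≤ 2 * c + 1 → y' < y → ver x y' ∈ S)
    (hh : ∀ y', y' < y → hor (2 * c) y' ∈ S) :
    ∀ x, 2 * c ≤ x → x ≤ 2 * c + 1 → (x + y) % 2 = 1 →
      (strip m i j).Linked S (2 * c + 1, -1) (x, y) := by
  have hmem : ∀ x y, 2 * c ≤ x → x ≤ 2 * c + 1 → 0 ≤ y → y < 3 * m →
      (x, y) ∈ stripVerts m i j := fun x y h1 h2 h3 h4 ↦
    ⟨.inl ⟨by dsimp only; omega, by dsimp only; omega, h3, h4⟩, .inr (by dsimp only; omega)⟩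
  induction y, hy0 using Int.leInduction with
  | base =>
    intro x h1 h2 h3
    obtain rfl : x = 2 * c + 1 := by omega
    refine .of_isLink (e := ver (2 * c + 1) (-1)) (strip_isLink ?_ ?_ ?_)
      (hv _ _ (by omega) (by omega) (by omega))
    · exact ⟨by omega, by omega, by omega, by omega, by omega⟩
    · exact ⟨.inr ⟨rfl, by simp only [src]; omega, by simp only [src]; omega,
        by simp only [src]; omega⟩, .inr (by simp only [src]; omega)⟩
    · exact hmem _ _ (by omega) (by omega) (by omega) (by omega)
  | succ y hy ih =>
    intro x h1 h2 h3
    have ih := ih (by omega) (fun x y' h1 h2 h3 ↦ hv x y' h1 h2 (by omega))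
      fun y' h ↦ hh y' (by omega)
    have hrow : (strip m i j).Linked S (2 * c, y) (2 * c + 1, y) :=
      .of_isLink (e := hor (2 * c) y) (strip_isLink ⟨by omega, by omega, hy, by omega⟩
        (hmem _ _ (by omega) (by omega) hy (by omega))
        (hmem _ _ (by omega) (by omega) hy (by omega))) (hh y (by omega))
    have hup : (strip m i j).Linked S (x, y) (x, y + 1) :=
      .of_isLink (e := ver x y) (strip_isLink ⟨by omega, by omega, by omega, by omega, by omega⟩
        (hmem _ _ (by omega) (by omega) hy (by omega))
        (hmem _ _ (by omega) (by omega) (by omega) hym)) (hv x y h1 h2 (by omega))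
    obtain rfl | rfl : x = 2 * c ∨ x = 2 * c + 1 := by omega
    · exact ((ih (2 * c + 1) (by omega) (by omega) (by omega)).trans hrow.symm).trans hup
    · exact ((ih (2 * c) (by omega) (by omega) (by omega)).trans hrow).trans hup

/-- The images of the vertices of the blown-up `K₄` in a strip. -/
def stripVert (m i j : ℤ) : Vert → ℤ × ℤ
  -- The hub lies in the middle row of the strip and in its middle pair of columns; the term `i % 2`
  -- selects the vertex with a vertical edge going down.
  | none => (6 * j + 2 + i % 2, 3 * i + 1)
  | some (t, r) => gad m t (![i, i, j] t) r

/-- The edge of the blown-up `K₄` whose image uses a given edge of the strip. -/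
def colour (i j : ℤ) : Edge → Bundle × ℕ
  | side t _ s n => ((t, sideBundle s), n)
  | ver x _ => (if x < 6 * j + 2 then (2, 4) else if x < 6 * j + 4 then (2, 3) else (1, 4), 0)
  | hor x y => (if y = 3 * i + 2 then (0, 4)
      else if y = 3 * i + 1 then if x < 6 * j + 2 + i % 2 then (0, 3) else (1, 3)
      else if x < 6 * j + 2 then (2, 4) else if x < 6 * j + 4 then (2, 3) else (1, 4), 0)

lemma stripVert_mem (hi : 0 ≤ i) (him : i < m) (hj : 0 ≤ j) (hjm : j < m)
    (v : Vert) : stripVert m i j v ∈ stripVerts m i j := by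
  match v with
  | none =>
    refine ⟨.inl ?_, .inl ?_⟩ <;> simp only [stripVert] <;> omega
  | some (t, r) =>
    obtain rfl | rfl | rfl := (by decide : ∀ t : Fin 3, t = 0 ∨ t = 1 ∨ t = 2) t
    · exact ⟨gad_mem hi him _ _, .inl (by simp [stripVert, gad]; omega)⟩
    · exact ⟨gad_mem hi him _ _, .inl (by simp [stripVert, gad]; omega)⟩
    · exact ⟨gad_mem hj hjm _ _, .inr (by simp [stripVert, gad]; omega)⟩

lemma stripVert_injective (hi : 0 ≤ i) (him : i < m) (hj : 0 ≤ j) (hjm : j < m) :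
    Function.Injective (stripVert m i j) := by
  have hκ : ∀ t, 0 ≤ ![i, i, j] t ∧ ![i, i, j] t < m := by
    intro t
    obtain rfl | rfl | rfl := (by decide : ∀ t : Fin 3, t = 0 ∨ t = 1 ∨ t = 2) t
    exacts [⟨hi, him⟩, ⟨hi, him⟩, ⟨hj, hjm⟩]
  have hne : ∀ t r, stripVert m i j none ≠ stripVert m i j (some (t, r)) := by
    intro t r h
    obtain rfl | rfl | rfl := (by decide : ∀ t : Fin 3, t = 0 ∨ t = 1 ∨ t = 2) t <;>
      simp [stripVert, gad] at h <;> omega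
  intro u v h
  match u, v with
  | none, none => rfl
  | none, some (t, r) => exact absurd h (hne t r)
  | some (t, r), none => exact absurd h.symm (hne t r)
  | some (t, r), some (t', r') =>
    obtain ⟨rfl, -⟩ := eq_of_cluster_gad_eq (hκ t).1 (hκ t).2 (hκ t').1 (hκ t').2
      (congrArg (cluster m) h)
    rw [gad_injective m t _ h]

/-- The spokes of the blown-up `K₄` can be routed in a strip. -/
lemma linked_spoke (hi : 0 ≤ i) (him : i < m) (hj : 0 ≤ j) (hjm : j < m)
    (t : Fin 3) : (strip m i j).Linked {f | colour i j f = ((t, 3), 0)}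
      (stripVert m i j (some (t, 1))) (stripVert m i j none) := by
  obtain rfl | rfl | rfl := (by decide : ∀ t : Fin 3, t = 0 ∨ t = 1 ∨ t = 2) t
  · have h1 : stripVert m i j (some (0, 1)) = (-1, 3 * i + 1) := by simp [stripVert, gad]
    rw [h1]
    refine linked_row (by omega) (by omega) (by omega) le_rfl (by omega) (by omega)
      fun x h1 h2 ↦ ?_
    simp [colour, h2]
  · have h1 : stripVert m i j (some (1, 1)) = (6 * m, 3 * i + 1) := by
      simp [stripVert, gad]; ring
    rw [h1]
    refine (linked_row (by omega) (by omega) (by omega) (by omega) (by omega) le_rfl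
      fun x h1 h2 ↦ ?_).symm
    simp [colour, not_lt.2 h1]
  · have h1 : stripVert m i j (some (2, 1)) = (2 * (3 * j + 1) + 1, -1) := by
      simp [stripVert, gad]; ring
    rw [h1]
    refine linked_column (by omega) (by omega) (by omega) (by omega) (by omega)
      (fun x y h1 h2 h3 ↦ ?_) (fun y h ↦ ?_) _ (by omega) (by omega) (by omega)
    · simp only [colour, Set.mem_ofPred_eq]
      rw [if_neg (by omega), if_pos (by omega)]
    · simp only [colour, Set.mem_ofPred_eq]
      rw [if_neg (by omega), if_neg (by omega), if_neg (by omega), if_pos (by omega)]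

/-- The edges between the fat triangles of the blown-up `K₄` can be routed in a strip. -/
lemma linked_triangles (hi : 0 ≤ i) (him : i < m) (hj : 0 ≤ j) (hjm : j < m)
    (t : Fin 3) : (strip m i j).Linked {f | colour i j f = ((t, 4), 0)}
      (stripVert m i j (some (t, 2))) (stripVert m i j (some (t + 1, 0))) := by
  obtain rfl | rfl | rfl := (by decide : ∀ t : Fin 3, t = 0 ∨ t = 1 ∨ t = 2) t
  · have h1 : stripVert m i j (some (0, 2)) = (-1, 3 * i + 2) := by simp [stripVert, gad]
    have h2 : stripVert m i j (some (0 + 1, 0)) = (6 * m, 3 * i + 2) := by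
      simp [stripVert, gad]
    rw [h1, h2]
    refine linked_row (by omega) (by omega) (by omega) le_rfl (by omega) (by omega)
      fun x h1 h2 ↦ ?_
    simp [colour]
  · have h1 : stripVert m i j (some (1, 2)) = (6 * m, 3 * i) := by simp [stripVert, gad]
    have h2 : stripVert m i j (some (1 + 1, 0)) = (2 * (3 * j + 2) + 1, -1) := by
      simp [stripVert, gad]; ring
    rw [h1, h2]
    refine .symm (.trans (linked_column (y := 3 * i) (by omega) (by omega) (by omega) (by omega)
      (by omega) (fun x y h1 h2 h3 ↦ ?_) (fun y h ↦ ?_) (6 * j + 5 - i % 2) (by omega) (by omega)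
      (by omega)) (linked_row (by omega) (by omega) (by omega) (by omega) (by omega) le_rfl
      fun x h1 h2 ↦ ?_))
    · simp only [colour, Set.mem_ofPred_eq]
      rw [if_neg (by omega), if_neg (by omega)]
    · simp only [colour, Set.mem_ofPred_eq]
      rw [if_neg (by omega), if_neg (by omega), if_neg (by omega), if_neg (by omega)]
    · simp only [colour, Set.mem_ofPred_eq]
      rw [if_neg (by omega), if_neg (by omega), if_neg (by omega), if_neg (by omega)]
  · have h1 : stripVert m i j (some (2, 2)) = (2 * (3 * j) + 1, -1) := by
      simp [stripVert, gad]; ring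
    have h2 : stripVert m i j (some (2 + 1, 0)) = (-1, 3 * i) := by
      simp [stripVert, gad]
    rw [h1, h2]
    refine .trans (linked_column (y := 3 * i) (by omega) (by omega) (by omega) (by omega)
      (by omega) (fun x y h1 h2 h3 ↦ ?_) (fun y h ↦ ?_) (6 * j + 1 - i % 2) (by omega) (by omega)
      (by omega)) (.symm (linked_row (by omega) (by omega) (by omega) le_rfl (by omega) (by omega)
      fun x h1 h2 ↦ ?_))
    · simp only [colour, Set.mem_ofPred_eq]
      rw [if_pos (by omega)]
    · simp only [colour, Set.mem_ofPred_eq]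
      rw [if_neg (by omega), if_neg (by omega), if_pos (by omega)]
    · simp only [colour, Set.mem_ofPred_eq]
      rw [if_neg (by omega), if_neg (by omega), if_pos (by omega)]

/-- The top row joins the left and right gadgets, and the middle row carries their spokes. The
middle pair of columns carries the spoke from the bottom. The outer pairs climb to the lowest row,
which leads them to the left and right gadgets; the middle pair crosses that row between them. -/
lemma linked_colour (hi : 0 ≤ i) (him : i < m) (hj : 0 ≤ j) (hjm : j < m)
    (e : Bundle × ℕ) (he : e.2 < bundleMult e.1) :
    (strip m i j).Linked {f | colour i j f = e} (stripVert m i j (fst e.1))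
      (stripVert m i j (snd e.1)) := by
  obtain ⟨⟨t, s⟩, n⟩ := e
  obtain ⟨s', rfl⟩ | rfl | rfl := (by decide : ∀ s : Fin 5,
    (∃ s' : Fin 3, s = sideBundle s') ∨ s = 3 ∨ s = 4) s
  · have hF : fst (t, sideBundle s') = some (t, sideFst s') :=
      (by decide : ∀ t (s' : Fin 3), fst (t, sideBundle s') = some (t, sideFst s')) t s'
    have hS : snd (t, sideBundle s') = some (t, sideSnd s') :=
      (by decide : ∀ t (s' : Fin 3), snd (t, sideBundle s') = some (t, sideSnd s')) t s'
    have hn : n < mult t s' := he.trans_eq ((by decide :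
      ∀ t (s' : Fin 3), bundleMult (t, sideBundle s') = mult t s') t s')
    have hκ : 0 ≤ ![i, i, j] t ∧ ![i, i, j] t < m := by
      obtain rfl | rfl | rfl := (by decide : ∀ t : Fin 3, t = 0 ∨ t = 1 ∨ t = 2) t
      exacts [⟨hi, him⟩, ⟨hi, him⟩, ⟨hj, hjm⟩]
    simp only [hF, hS]
    exact .of_isLink (e := side t (![i, i, j] t) s' n) (strip_isLink ⟨hκ.1, hκ.2, hn⟩
      (stripVert_mem hi him hj hjm (some (t, sideFst s')))
      (stripVert_mem hi him hj hjm (some (t, sideSnd s')))) rfl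
  · obtain rfl : n = 0 := Nat.lt_one_iff.1 he
    exact linked_spoke hi him hj hjm t
  · obtain rfl : n = 0 := Nat.lt_one_iff.1 he
    exact linked_triangles hi him hj hjm t

lemma isoToMember_strip (hi : 0 ≤ i) (him : i < m) (hj : 0 ≤ j) (hjm : j < m) :
    ErdosPosa.IsoToMember (ErdosPosa.immersionClass BlownK4.graph) (strip m i j) := by
  refine ⟨_, _, strip m i j, ⟨strip_isFiniteLoopless, ?_⟩, .refl _⟩
  refine containsImmersion_of_linked (stripVert m i j) (fun e ↦ {f | colour i j f = e})
    (stripVert_injective hi him hj hjm).injOn (fun v _ ↦ stripVert_mem hi him hj hjm v) ?_ ?_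
  · intro e _ e' _ hne
    -- Colour classes of a function are disjoint, so edge-disjointness of the routes comes for free.
    exact Set.disjoint_left.2 fun f h h' ↦ hne (h.symm.trans h')
  · exact fun e he ↦ ⟨_, _, BlownK4.isLink he, linked_colour hi him hj hjm e he⟩

end

/-- Finitely many vertices of the wall miss some strip. -/
lemma exists_strip_disjoint (n : ℕ) (S : Finset (ℤ × ℤ)) (hS : S.card ≤ n) :
    ∃ i j : ℤ, 0 ≤ i ∧ i < (n + 1 : ℕ) ∧ 0 ≤ j ∧ j < (n + 1 : ℕ) ∧
      ∀ p ∈ S, p ∉ stripVerts (n + 1 : ℕ) i j := by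
  have key : ∀ f : ℤ × ℤ → ℤ, ∃ i : ℤ, 0 ≤ i ∧ i < (n + 1 : ℕ) ∧ ∀ p ∈ S, f p ≠ i := by
    intro f
    have hcard : (S.image f).card < (Finset.Ico (0 : ℤ) (n + 1 : ℕ)).card := by
      rw [Int.card_Ico]
      have := (Finset.card_image_le (s := S) (f := f)).trans hS
      simp only [sub_zero, Int.toNat_natCast]
      omega
    obtain ⟨i, hi, hi'⟩ := Finset.exists_mem_notMem_of_card_lt_card hcard
    rw [Finset.mem_Ico] at hi
    exact ⟨i, hi.1, hi.2, fun p hp h ↦ hi' (h ▸ Finset.mem_image_of_mem f hp)⟩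
  obtain ⟨i, h1, h2, h3⟩ := key fun p ↦ p.2 / 3
  obtain ⟨j, h4, h5, h6⟩ := key fun p ↦ p.1 / 6
  exact ⟨i, j, h1, h2, h4, h5, fun p hp h ↦ h.2.elim (h3 p hp) (h6 p hp)⟩

lemma not_hasVertexCover (n : ℕ) :
    ¬ ErdosPosa.HasVertexCover (ErdosPosa.immersionClass BlownK4.graph) (graph (n + 1 : ℕ)) n := by
  rintro ⟨S, -, hS, h⟩
  obtain ⟨i, j, hi, hi', hj, hj', hd⟩ := exists_strip_disjoint n S hS
  obtain ⟨v, hv, hv'⟩ := h _ (strip_le _ i j) (isoToMember_strip hi hi' hj hj')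
  exact hd v hv hv'

lemma not_hasEdgeCover (n : ℕ) :
    ¬ ErdosPosa.HasEdgeCover (ErdosPosa.immersionClass BlownK4.graph) (graph (n + 1 : ℕ)) n := by
  rintro ⟨S, -, hS, h⟩
  obtain ⟨i, j, hi, hi', hj, hj', hd⟩ :=
    -- A strip is an induced subgraph, so it contains both ends of each of its edges; avoiding one
    -- end of every edge of `S` avoids `S`.
    exists_strip_disjoint n (S.image (src (n + 1 : ℕ))) (Finset.card_image_le.trans hS)
  obtain ⟨e, he, he'⟩ := h _ (strip_le _ i j) (isoToMember_strip hi hi' hj hj')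
  obtain ⟨x, y, ⟨-, hl⟩, hx, hy⟩ := exists_isLink_of_mem_edgeSet he'
  refine hd _ (Finset.mem_image_of_mem _ he) ?_
  obtain ⟨rfl, -⟩ | ⟨-, rfl⟩ := hl
  exacts [hx, hy]

end Graph.Wall

theorem mainTheorem9 :
    ∃ (α β : Type) (H : Graph α β),
      H.IsFiniteLoopless ∧ H.IsKConnected 3 ∧ H.IsPlanar ∧ ¬ H.IsSubcubic ∧
      ¬ ErdosPosa.HasVertexErdosPosaProperty (ErdosPosa.immersionClass H) ∧
      ¬ ErdosPosa.HasEdgeErdosPosaProperty (ErdosPosa.immersionClass H) ∧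
      ∀ n : ℕ, ∃ (α' β' : Type) (G : Graph α' β'), G.IsFiniteLoopless ∧
        ¬ ErdosPosa.HasVertexPacking (ErdosPosa.immersionClass H) G 2 ∧
        ¬ ErdosPosa.HasEdgePacking (ErdosPosa.immersionClass H) G 2 ∧
        ¬ ErdosPosa.HasVertexCover (ErdosPosa.immersionClass H) G n ∧
        ¬ ErdosPosa.HasEdgeCover (ErdosPosa.immersionClass H) G n := by
  refine ⟨_, _, Graph.BlownK4.graph, Graph.BlownK4.isFiniteLoopless, Graph.BlownK4.isKConnected,
    Graph.BlownK4.isPlanar, Graph.BlownK4.not_isSubcubic, ?_, ?_, fun n ↦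
    ⟨_, _, Graph.Wall.graph (n + 1 : ℕ), Graph.Wall.isFiniteLoopless _,
      Graph.Wall.not_hasVertexPacking _, Graph.Wall.not_hasEdgePacking _,
      Graph.Wall.not_hasVertexCover n, Graph.Wall.not_hasEdgeCover n⟩⟩
  · rintro ⟨f, hf⟩
    -- The wall with `f 2 + 1` gadgets of each type has no packing of size `2` and no cover of size
    -- at most `f 2`.
    exact (hf _ _ _ (Graph.Wall.isFiniteLoopless (f 2 + 1 : ℕ)) 2).elim
      (Graph.Wall.not_hasVertexPacking _) (Graph.Wall.not_hasVertexCover _)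
  · rintro ⟨f, hf⟩
    exact (hf _ _ _ (Graph.Wall.isFiniteLoopless (f 2 + 1 : ℕ)) 2).elim
      (Graph.Wall.not_hasEdgePacking _) (Graph.Wall.not_hasEdgeCover _)
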